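/- **Setting.** Fix integers $d\ge 1$ and $n$. For every even $L\ge 2$ let $\Lambda=\Lambda_L=(\mathbb Z/L\mathbb Z)^d$ be the discrete torus with its graph distance, each coordinate being identified with an element of $\{-L/2+1,\dots,L/2\}$. Consider on $\Lambda$ either the spin system with Hilbert space $\bigotimes_{x\in\Lambda}\mathbb C^n$, where $\mathcal A_X$ is the algebra of operators of the form $O_X\otimes 1_{\Lambda\setminus X}$, or the fermionic Fock space over $\ell^2(\Lambda,\mathbb C^n)$, where $\mathcal A_X$ is the algebra generated by the monomials with an even number of creation and annihilation operators at sites of $X$. Put $$\Gamma=\{0\le x_1<L/2\},\quad \partial_-=\{x_1=0\},\quad \partial_+=\{x_1=L/2-1\},\quad S_-=\{|x_1|\le L/8\},\quad S_+=\{|x_1-L/2|\le L/8\},$$ where $x_1-L/2$ is taken modulo $L$ (with representative in $\{-L/2+1,\dots,L/2\}$), and $X^r=\{x\in\Lambda:\mathrm{dist}(x,X)\le r\}$. Let $Q_x=Q_x^*\in\mathcal A_{\{x\}}$ have integer spectrum, let $Q_X=\sum_{x\in X}Q_x$ and $Q=Q_\Gamma$, and assume $\|Q\|\le q|\Lambda|$.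 Models are given for every even $L$; constants do not depend on $L$, and $O(L^{-\infty})$ denotes a quantity bounded, for every $k$, by $C_kL^{-k}$ for all even $L\ge2$. A *finite-range charge-conserving generator* is a family $G(s)=\sum_{X\subset\Lambda}\Phi_X(s)$, $s\in[0,1]$, with $\Phi_X(s)=\Phi_X(s)^*\in\mathcal A_X$ continuous in $s$, such that for some $R,m<\infty$ independent of $s$ and $L$: $\Phi_X(s)=0$ if $\mathrm{diam}(X)>R$; $\|\Phi_X(s)\|\le m$ for all $X$; and $[\Phi_X(s),Q_Y]=0$ whenever $X\subset Y$. Assume that $G$ satisfies one of the following: (a) $G$ is a finite-range charge-conserving generator; (b) (quasi-local tails) $G(s)=\sum_{X\subset\Lambda}\Phi_X(s)$ is such that for each $R<\infty$ the truncation $G^{(R)}(s)=\sum_{\mathrm{diam}(X)<R}\Phi_X(s)$ is a finite-range charge-conserving generator (with range and strength that may depend on $R$, but not on $s,L$), $$\frac1{|\Lambda|}\sum_{\mathrm{diam}(X)\ge R}\|\Phi_X(s)\|=O(R^{-\infty})\quad\text{uniformly in } s\text{ and }L,$$ and $\sum_{X\ni x}\|\Phi_X(s)\|\le J$ for some $J<\infty$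 and all $x$, $s$, $L$. Let $U(s)$ solve $\mathrm i\,\partial_sU(s)=G(s)U(s)$ on $[0,1]$, $U(0)=1$, let $U_\pm(s)$ solve the same equation with $G(s)$ replaced by $G_\pm(s)=\sum_{X\subset\partial_\pm^{L/12}}\Phi_X(s)$, and put $U=U(1)$, $U_\pm=U_\pm(1)$, $T_\pm=U_\pm^*QU_\pm-Q$. **Claim.** In either case: 1. $\|U^*QU-Q-(T_++T_-)\|=O(L^{-\infty})$; 2. $T_\pm\in\mathcal A_{S_\pm}$ for all even $L\ge16$, and $T_\pm$ are self-adjoint for all $L$; 3. $\|e^{2\pi\mathrm i(Q+T_-)}-1\|=O(L^{-\infty})$ and $\|T_\pm\|\le C|\Lambda|$ with $C$ independent of $L$. -/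

import Mathlib

noncomputable section

namespace ChargeTransport

/-! ### The discrete torus -/

/-- The discrete `d`-torus `(ℤ / L ℤ) ^ d`. -/
abbrev Torus (d L : ℕ) : Type := Fin d → ZMod L

/-- The even side lengths `L = 2, 4, 6, …`, listed by `N = 0, 1, 2, …`. -/
abbrev side (N : ℕ) : ℕ := 2 * N + 2

section Geometry

variable {d L : ℕ}

/-- Graph distance on the torus, each coordinate contributing its circular distance on `ℤ / L ℤ`:
`ZMod.valMinAbs` is the representative in `{-L/2+1, …, L/2}`. -/
def tdist (x y : Torus d L) : ℕ := ∑ i, (x i - y i).valMinAbs.natAbs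

/-- Diameter of a finite set of sites (`0` for the empty set). -/
def diam (X : Finset (Torus d L)) : ℕ := X.sup fun x => X.sup fun y => tdist x y

variable [NeZero d] [NeZero L]

/-- The coordinate `x₁` as an integer in `{-L/2+1, …, L/2}`. -/
def coord (x : Torus d L) : ℤ := (x 0).valMinAbs

variable (d L)

/-- The half-torus `Γ = {0 ≤ x₁ < L/2}`. -/
def halfTorus : Finset (Torus d L) :=
  Finset.univ.filter fun x => 0 ≤ coord x ∧ 2 * coord x < (L : ℤ)

/-- The boundary `∂₋ = {x₁ = 0}`. -/
def bdryMinus : Finset (Torus d L) := Finset.univ.filter fun x => x 0 = 0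

/-- The boundary `∂₊ = {x₁ = L/2 - 1}`. -/
def bdryPlus : Finset (Torus d L) :=
  Finset.univ.filter fun x => x 0 = ((L / 2 : ℕ) : ZMod L) - 1

/-- The strip `S₋`: sites with `|x₁| ≤ L/8`. -/
def stripMinus : Finset (Torus d L) :=
  Finset.univ.filter fun x => 8 * |(x 0).valMinAbs| ≤ (L : ℤ)

/-- The strip `S₊`: sites with `|x₁ - L/2| ≤ L/8`, where `x₁ - L/2` is taken modulo `L`. -/
def stripPlus : Finset (Torus d L) :=
  Finset.univ.filter fun x => 8 * |(x 0 - ((L / 2 : ℕ) : ZMod L)).valMinAbs| ≤ (L : ℤ)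

variable {d L}

/-- The fattening `X ^ r`: sites at distance at most `r` from `X`. -/
def fatten (X : Finset (Torus d L)) (r : ℕ) : Finset (Torus d L) :=
  Finset.univ.filter fun x => ∃ y ∈ X, tdist x y ≤ r

end Geometry

/-! ### Spin and fermion systems -/

/-- The two kinds of lattice systems. -/
inductive Species
  | spin
  | fermion

/-- Labels of the standard orthonormal basis of the Hilbert space. For spins these are the
configurations `Λ → {1, …, n}`, so that the space is the tensor product of copies of `ℂⁿ`; for
fermions they are the sets of occupied modes in `Λ × {1, …, n}`, so that the space is the
antisymmetric Fock space over `ℓ²(Λ, ℂⁿ)` in the occupation number basis. -/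
def Label (sp : Species) (n d L : ℕ) : Type :=
  match sp with
  | .spin => Torus d L → Fin n
  | .fermion => Finset (Torus d L × Fin n)

instance (sp : Species) (n d L : ℕ) [NeZero L] : Fintype (Label sp n d L) :=
  match sp with
  | .spin => inferInstanceAs (Fintype (Torus d L → Fin n))
  | .fermion => inferInstanceAs (Fintype (Finset (Torus d L × Fin n)))

instance (sp : Species) (n d L : ℕ) [NeZero L] : DecidableEq (Label sp n d L) :=
  match sp with
  | .spin => inferInstanceAs (DecidableEq (Torus d L → Fin n))
  | .fermion => inferInstanceAs (DecidableEq (Finset (Torus d L × Fin n)))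

/-- The Hilbert space of the system. -/
abbrev HilbertSp (sp : Species) (n d L : ℕ) : Type := EuclideanSpace ℂ (Label sp n d L)

/-- All operators on the Hilbert space, with the operator norm and the adjoint as `star`. -/
abbrev Op (sp : Species) (n d L : ℕ) [NeZero L] : Type :=
  HilbertSp sp n d L →L[ℂ] HilbertSp sp n d L

section Algebras

variable {n d L : ℕ} [NeZero L]

/-- The operator with a given matrix in the standard basis. -/
def ofMatrix {sp : Species} (M : Matrix (Label sp n d L) (Label sp n d L) ℂ) : Op sp n d L :=
  Matrix.toEuclideanCLM (𝕜 := ℂ) M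

/-- Spin observables supported in `X`: the operators `O ⊗ 1` with `O` acting on the sites of
`X`. -/
def spinAlg (X : Finset (Torus d L)) : Set (Op .spin n d L) :=
  {A | ∃ O : Matrix (X → Fin n) (X → Fin n) ℂ,
    A = ofMatrix (sp := .spin) (Matrix.of fun (σ τ : Torus d L → Fin n) =>
      if ∀ x, x ∉ X → σ x = τ x then O (fun x => σ x) (fun x => τ x) else 0)}

/-- The number of occupied modes of `S` that precede the mode `j`, in a fixed enumeration. -/
def precede (S : Finset (Torus d L × Fin n)) (j : Torus d L × Fin n) : ℕ :=
  (S.filter fun k => Fintype.equivFin (Torus d L × Fin n) k <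
    Fintype.equivFin (Torus d L × Fin n) j).card

/-- The fermionic annihilation operator of the mode `j`: it maps the basis vector of `T` to
`±` the basis vector of `T \ {j}` if `j ∈ T`, and to `0` otherwise. -/
def annihilate (j : Torus d L × Fin n) : Op .fermion n d L :=
  ofMatrix (sp := .fermion) (Matrix.of fun (S T : Finset (Torus d L × Fin n)) =>
    if j ∈ T ∧ S = T.erase j then (-1 : ℂ) ^ precede T j else 0)

/-- The annihilation and creation operators of the modes at the sites of `X`. -/
def fermiGenerators (X : Finset (Torus d L)) : Set (Op .fermion n d L) :=
  {a | ∃ j : Torus d L × Fin n, j.1 ∈ X ∧ (a = annihilate j ∨ a = star (annihilate j))}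

/-- Even fermionic observables supported in `X`: the algebra generated by all monomials with an
even number of creation and annihilation operators at sites of `X`. -/
def fermiAlg (X : Finset (Torus d L)) : Set (Op .fermion n d L) :=
  (Algebra.adjoin ℂ {A : Op .fermion n d L | ∃ l : List (Op .fermion n d L),
    (∀ a ∈ l, a ∈ fermiGenerators X) ∧ Even l.length ∧ A = l.prod} :
      Subalgebra ℂ (Op .fermion n d L))

/-- The observables supported in `X`. -/
def localAlg (sp : Species) (X : Finset (Torus d L)) : Set (Op sp n d L) :=
  match sp with
  | .spin => spinAlg X
  | .fermion => fermiAlg X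

end Algebras

/-! ### Charges, generators and propagators -/

section Dynamics

variable {sp : Species} {n d L : ℕ} [NeZero L]

/-- The charge `Q_X` of a region. -/
def charge (Q : Torus d L → Op sp n d L) (X : Finset (Torus d L)) : Op sp n d L := ∑ x ∈ X, Q x

/-- Local charge operators: self-adjoint, supported on one site, with integer spectrum. -/
structure IsLocalCharge (Q : Torus d L → Op sp n d L) : Prop where
  mem : ∀ x, Q x ∈ localAlg sp {x}
  selfAdjoint : ∀ x, IsSelfAdjoint (Q x)
  integer : ∀ x, spectrum ℂ (Q x) ⊆ Set.range fun k : ℤ => (k : ℂ)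

/-- A time-dependent interaction on `[0, 1]` with range `R` and strength `m`, locally conserving
the charge `Q`. -/
structure IsLocalGenerator (Q : Torus d L → Op sp n d L)
    (Φ : Finset (Torus d L) → ℝ → Op sp n d L) (R : ℕ) (m : ℝ) : Prop where
  mem : ∀ X, ∀ s ∈ Set.Icc (0 : ℝ) 1, Φ X s ∈ localAlg sp X
  selfAdjoint : ∀ X, ∀ s ∈ Set.Icc (0 : ℝ) 1, IsSelfAdjoint (Φ X s)
  continuousOn : ∀ X, ContinuousOn (Φ X) (Set.Icc (0 : ℝ) 1)
  range : ∀ X, R < diam X → ∀ s ∈ Set.Icc (0 : ℝ) 1, Φ X s = 0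
  strength : ∀ X, ∀ s ∈ Set.Icc (0 : ℝ) 1, ‖Φ X s‖ ≤ m
  conserve : ∀ X Y, X ⊆ Y → ∀ s ∈ Set.Icc (0 : ℝ) 1, Commute (Φ X s) (charge Q Y)

/-- The truncated interaction, keeping the terms with `diam X < R`. -/
def truncate (R : ℕ) (Φ : Finset (Torus d L) → ℝ → Op sp n d L) :
    Finset (Torus d L) → ℝ → Op sp n d L :=
  fun X s => if diam X < R then Φ X s else 0

/-- The generator `G(s) = ∑_X Φ_X(s)`. -/
def generator (Φ : Finset (Torus d L) → ℝ → Op sp n d L) (s : ℝ) : Op sp n d L := ∑ X, Φ X s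

/-- The restricted generator: the sum of the terms `Φ_X(s)` with `X ⊆ Y`. -/
def generatorIn (Y : Finset (Torus d L)) (Φ : Finset (Torus d L) → ℝ → Op sp n d L) (s : ℝ) :
    Op sp n d L := ∑ X ∈ Y.powerset, Φ X s

/-- `U` solves `i ∂ₛ U(s) = G(s) U(s)` on `[0, 1]` with `U(0) = 1`. -/
def IsPropagator (G U : ℝ → Op sp n d L) : Prop :=
  U 0 = 1 ∧ ∀ s ∈ Set.Icc (0 : ℝ) 1,
    HasDerivWithinAt U (-Complex.I • (G s * U s)) (Set.Icc (0 : ℝ) 1) s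

/-- The transported charge `V* Q V - Q`, where `Q` is the charge of the half-torus. -/
def transported [NeZero d] (Q : Torus d L → Op sp n d L) (V : Op sp n d L) : Op sp n d L :=
  star V * charge Q (halfTorus d L) * V - charge Q (halfTorus d L)

end Dynamics

/-- A quantity depending on the even side length `L = side N` is `O(L^{-∞})`. -/
def IsVerySmall (f : ℕ → ℝ) : Prop := ∀ k : ℕ, ∃ C : ℝ, ∀ N, |f N| ≤ C / (side N : ℝ) ^ k

/-- A sequence of finite-range generators: range and strength do not depend on `L`. -/
def FiniteRange {sp : Species} {n d : ℕ} (Q : ∀ N, Torus d (side N) → Op sp n d (side N))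
    (Φ : ∀ N, Finset (Torus d (side N)) → ℝ → Op sp n d (side N)) : Prop :=
  ∃ (R : ℕ) (m : ℝ), ∀ N, IsLocalGenerator (Q N) (Φ N) R m

/-- A sequence of generators with quasi-local tails: each truncation is a finite-range generator,
the terms with `diam X ≥ R` have norm `O(R^{-∞})` per unit volume, and the terms that contain a
given site have bounded total norm, all uniformly in `L` and in the time. -/
structure QuasiLocal {sp : Species} {n d : ℕ} (Q : ∀ N, Torus d (side N) → Op sp n d (side N))
    (Φ : ∀ N, Finset (Torus d (side N)) → ℝ → Op sp n d (side N)) : Prop where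
  truncated : ∀ R : ℕ, FiniteRange Q fun N => truncate R (Φ N)
  tail : ∀ k : ℕ, ∃ C : ℝ, ∀ R : ℕ, 1 ≤ R → ∀ N, ∀ s ∈ Set.Icc (0 : ℝ) 1,
    (∑ X with R ≤ diam X, ‖Φ N X s‖) / (side N : ℝ) ^ d ≤ C / (R : ℝ) ^ k
  perSite : ∃ J : ℝ, ∀ N, ∀ s ∈ Set.Icc (0 : ℝ) 1, ∀ x, ∑ X with x ∈ X, ‖Φ N X s‖ ≤ J

end ChargeTransport

end

open ChargeTransport

/-! The derivative of `U* Q U` is `i U* [G, Q] U`, and `[G, Q]` is a sum of currents `[Φ_X, Q]`. A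
current vanishes if `X` misses Γ (locality) or lies in Γ (conservation), so only sets straddling the
edge of Γ contribute. At range `R` these lie within `2R` of one of the two boundaries, whence `[G,
Q] = [G₊, Q] + [G₋, Q]`. A current near `∂±` evolves almost equally under `G` and `G±`, because the
omitted terms are far away; integrating over time yields the splitting
(`IsShortRange.norm_transported_sub_le`). The comparison rests on `lieb_robinson`, whose error is `κ
^ k / k!` with `κ` of order `J R ^ d` when `k` steps of the range separate the supports. It comes
from `norm_le_of_deriv_commutator_add`, a growth bound blind to commutator terms.

A quasi-local generator is first truncated at range `R`, which costs a multiple of the discarded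
norm times `‖Q‖` (`norm_transported_sub_le_of_truncate`). Taking `R` near `L ^ (1 / (d + 3))` and `k
= R ^ (d + 1)` makes both errors `O(L^{-∞})`. The norm per site is bounded by a `J` independent of
`R`, so the uncontrolled constants of the truncations never enter. Finite range is a special case
(`FiniteRange.quasiLocal`).

The remaining claims are exact. `U±` is the solution of an equation inside the algebra of its strip,
and the charge outside the strip commutes with it, so `T±` is localized. Moreover `Q + T₋ = U₋* Q
U₋` is unitarily conjugate to `Q`, a sum of commuting operators with integer spectrum, so its
exponential equals 1. -/

open ChargeTransport

namespace ChargeTransport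

section

open Set Filter Topology MeasureTheory

/-! ### Linear differential equations in a Banach algebra: the Dyson series. -/

section LinearODE

variable {A : Type*} [NormedRing A] [NormedAlgebra ℝ A]

/-- The terms of the Dyson series of `X' = F X`, `X(0) = 1`. -/
noncomputable def dysonTerm (F : ℝ → A) : ℕ → ℝ → A
  | 0 => fun _ => 1
  | k + 1 => fun t => ∫ s in (0 : ℝ)..t, F s * dysonTerm F k s

lemma continuous_dysonTerm {F : ℝ → A} (hF : Continuous F) : ∀ k, Continuous (dysonTerm F k)
  | 0 => continuous_const
  | k + 1 => intervalIntegral.continuous_primitive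
      (fun _ _ => (hF.mul (continuous_dysonTerm hF k)).intervalIntegrable _ _) 0

lemma hasDerivAt_dysonTerm_succ [CompleteSpace A] {F : ℝ → A} (hF : Continuous F) (k : ℕ) (t : ℝ) :
    HasDerivAt (dysonTerm F (k + 1)) (F t * dysonTerm F k t) t :=
  (hF.mul (continuous_dysonTerm hF k)).integral_hasStrictDerivAt 0 t |>.hasDerivAt

/-- The factorial is the volume of the simplex of ordered times. The factor `‖1‖` is kept because
the algebra may be zero, as for spins with `n = 0`. -/
lemma norm_dysonTerm_le {F : ℝ → A} {M : ℝ} (hM : ∀ t, ‖F t‖ ≤ M) (k : ℕ) (t : ℝ) :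
    ‖dysonTerm F k t‖ ≤ (M * |t|) ^ k / k.factorial * ‖(1 : A)‖ := by
  have hM0 : 0 ≤ M := (norm_nonneg _).trans (hM 0)
  induction k generalizing t with
  | zero => simp [dysonTerm]
  | succ k ih =>
    have h1 : ∀ s, ‖F s * dysonTerm F k s‖ ≤
        M ^ (k + 1) / k.factorial * ‖(1 : A)‖ * |s - 0| ^ k := fun s => by
      calc _ ≤ ‖F s‖ * ‖dysonTerm F k s‖ := norm_mul_le _ _
        _ ≤ M * ((M * |s|) ^ k / k.factorial * ‖(1 : A)‖) :=
          mul_le_mul (hM s) (ih s) (norm_nonneg _) hM0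
        _ = _ := by rw [mul_pow, sub_zero]; ring
    calc ‖dysonTerm F (k + 1) t‖ ≤ ∫ s in uIoc 0 t, ‖F s * dysonTerm F k s‖ :=
          intervalIntegral.norm_integral_le_integral_norm_uIoc
      _ ≤ ∫ s in uIoc 0 t, M ^ (k + 1) / k.factorial * ‖(1 : A)‖ * |s - 0| ^ k := by
          apply integral_mono_of_nonneg (Eventually.of_forall fun _ => norm_nonneg _)
            _ (Eventually.of_forall h1)
          exact Continuous.integrableOn_uIoc (by fun_prop)
      _ = _ := by
          rw [integral_const_mul, integral_pow_abs_sub_uIoc, sub_zero, Nat.factorial_succ]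
          push_cast
          rw [mul_pow]
          field_simp

/-- Existence of solutions of a linear differential equation on `[0, 1]`. -/
theorem exists_solution_linearODE [CompleteSpace A] {F : ℝ → A} (hF : ContinuousOn F (Icc 0 1)) :
    ∃ X : ℝ → A, X 0 = 1 ∧
      ∀ s ∈ Icc (0 : ℝ) 1, HasDerivWithinAt X (F s * X s) (Icc (0 : ℝ) 1) s := by
  set H : ℝ → A := IccExtend (zero_le_one' ℝ) ((Icc 0 1).domRestrict F) with hH
  have hHc : Continuous H := (continuousOn_iff_continuous_domRestrict.1 hF).Icc_extend'
  obtain ⟨M, hM⟩ : ∃ M, ∀ t, ‖H t‖ ≤ M := by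
    obtain ⟨M, hM⟩ := isCompact_Icc.exists_bound_of_continuousOn hF
    exact ⟨M, fun t => hM _ (projIcc 0 1 zero_le_one t).2⟩
  have hM0 : 0 ≤ M := (norm_nonneg _).trans (hM 0)
  set X : ℝ → A := fun t => ∑' k, dysonTerm H k t with hX
  have hsum : ∀ t, Summable fun k => dysonTerm H k t := fun t =>
    .of_norm_bounded ((Real.summable_pow_div_factorial _).mul_right _) (norm_dysonTerm_le hM · t)
  have hX' : ∀ t, X t = 1 + ∑' k, dysonTerm H (k + 1) t := fun t =>
    (hsum t).tsum_eq_zero_add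
  -- Termwise differentiation needs an open connected set. `F` has been extended by constants beyond
  -- `[0, 1]`, so a neighbourhood of the interval is available, with `|y| ≤ 2` on it.
  have hderiv : ∀ t ∈ Ioo (-1 : ℝ) 2, HasDerivAt X (H t * X t) t := by
    intro t ht
    have h := hasDerivAt_tsum_of_isPreconnected (𝕜 := ℝ) (t := Ioo (-1 : ℝ) 2) (y₀ := 0) (y := t)
      (g := fun k => dysonTerm H (k + 1)) (g' := fun k t => H t * dysonTerm H k t)
      (u := fun k => M * ((M * 2) ^ k / k.factorial * ‖(1 : A)‖))
      (((Real.summable_pow_div_factorial _).mul_right _).mul_left _) isOpen_Ioo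
      isPreconnected_Ioo (fun k y _ => hasDerivAt_dysonTerm_succ hHc k y)
      (fun k y hy => (norm_mul_le _ _).trans <| mul_le_mul (hM y)
        ((norm_dysonTerm_le hM k y).trans <| by
          have : |y| ≤ 2 := abs_le.2 ⟨by linarith [hy.1], hy.2.le⟩
          gcongr) (norm_nonneg _) hM0)
      ⟨by norm_num, by norm_num⟩ ((summable_nat_add_iff 1).2 (hsum 0)) ht
    rw [Summable.tsum_mul_left _ (hsum t)] at h
    have h2 := h.const_add 1
    exact h2.congr_of_eventuallyEq (Eventually.of_forall hX')
  refine ⟨X, ?_, fun s hs => ?_⟩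
  · rw [hX', tsum_eq_single 0 fun k hk => ?_] <;> simp [dysonTerm]
  · have h := hderiv s ⟨by linarith [hs.1], by linarith [hs.2]⟩
    have h3 : H s = F s := by rw [hH, IccExtend_of_mem _ _ hs]; rfl
    rw [h3] at h
    exact h.hasDerivWithinAt

end LinearODE

/-! ### A growth bound insensitive to commutators. -/

section CStar

variable {A : Type*} [CStarAlgebra A]

lemma hasDerivWithinAt_Ici_of_Icc {E : Type*} [NormedAddCommGroup E] [NormedSpace ℝ E]
    {f : ℝ → E} {f' : E} {a b t : ℝ} (ht : t ∈ Ico a b)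
    (h : HasDerivWithinAt f f' (Icc a b) t) : HasDerivWithinAt f f' (Ici t) t :=
  h.mono_of_mem_nhdsWithin (Icc_mem_nhdsGE_of_mem ht)

/-- The commutator with a self-adjoint element in the derivative does not contribute to the growth
of the norm. -/
theorem norm_le_of_deriv_commutator_add {D K E : ℝ → A} {T : ℝ} {b b' : ℝ → ℝ}
    (hK : ∀ t ∈ Icc 0 T, IsSelfAdjoint (K t))
    (hD : ∀ t ∈ Icc 0 T, HasDerivWithinAt D
      (Complex.I • (K t * D t - D t * K t) + E t) (Icc 0 T) t)
    (h0 : ‖D 0‖ ≤ b 0) (hb : ∀ t, HasDerivAt b (b' t) t)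
    (hE : ∀ t ∈ Icc 0 T, ‖E t‖ ≤ b' t) : ∀ t ∈ Icc 0 T, ‖D t‖ ≤ b t := by
  let : NormedAlgebra ℚ A := .restrictScalars ℚ ℝ A
  have hDc : ContinuousOn D (Icc 0 T) := fun t ht => (hD t ht).continuousWithinAt
  refine image_le_of_liminf_slope_right_le_deriv_boundary (f := fun t => ‖D t‖) hDc.norm h0
    (fun t _ => (hb t).continuousAt.continuousWithinAt) (fun t _ => (hb t).hasDerivWithinAt) ?_
  intro t ht r hr
  have ht' : t ∈ Icc 0 T := ⟨ht.1, ht.2.le⟩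
  set k : A := Complex.I • K t with hk
  have hskew : k ∈ skewAdjoint A := (hK t ht').smul_mem_skewAdjoint Complex.conj_I
  have hu : ∀ z : ℝ, NormedSpace.exp (z • k) ∈ unitary A := fun z =>
    NormedSpace.exp_mem_unitary_of_mem_skewAdjoint (skewAdjoint.smul_mem z hskew)
  -- Conjugating by the exponential of the frozen `K t` leaves norms unchanged and cancels the
  -- commutator at `z = t`. Only `E t` remains, and no regularity of `K` in time is needed.
  have hder : HasDerivWithinAt
      (fun z => NormedSpace.exp ((t - z) • k) * D z * NormedSpace.exp ((z - t) • k))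
      (E t) (Ici t) t := by
    have e1 : HasDerivAt (fun z : ℝ => NormedSpace.exp ((t - z) • k)) (-k) t := by
      have := (hasDerivAt_exp_smul_const k (t - t)).scomp (h := fun z => t - z) t ((hasDerivAt_id t).const_sub t)
      simpa [Function.comp_def] using this
    have e2 : HasDerivAt (fun z : ℝ => NormedSpace.exp ((z - t) • k)) k t := by
      have := (hasDerivAt_exp_smul_const k (t - t)).scomp (h := fun z => z - t) t ((hasDerivAt_id t).sub_const t)
      simpa [Function.comp_def] using this
    have e3 := (e1.hasDerivWithinAt.mul (hasDerivWithinAt_Ici_of_Icc ht (hD t ht'))).mul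
      (e2.hasDerivWithinAt (s := Ici t))
    refine e3.congr_deriv ?_
    simp only [sub_self, zero_smul, NormedSpace.exp_zero, one_mul, mul_one, hk, smul_sub,
      smul_mul_assoc, mul_smul_comm, neg_mul, Pi.mul_apply]
    module
  have := hder.liminf_right_slope_norm_le (lt_of_le_of_lt (hE t ht') hr)
  refine this.mono fun z hz => ?_
  rw [CStarRing.norm_mul_mem_unitary _ (hu _), CStarRing.norm_mem_unitary_mul _ (hu _),
    CStarRing.norm_mul_mem_unitary _ (hu _), CStarRing.norm_mem_unitary_mul _ (hu _)] at hz
  simpa [slope_def_field, div_eq_inv_mul] using hz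

end CStar

/-! ### Propagators: existence, unitarity, stability, invariance of subalgebras. -/

section Propagators

variable {A : Type*} [CStarAlgebra A] {G H U V : ℝ → A}

/-- `U` solves `i ∂ₛ U(s) = G(s) U(s)` on `[0, 1]` with `U(0) = 1`, in a C⋆-algebra. -/
def EvolvesBy (G U : ℝ → A) : Prop :=
  U 0 = 1 ∧ ∀ s ∈ Set.Icc (0 : ℝ) 1,
    HasDerivWithinAt U (-Complex.I • (G s * U s)) (Set.Icc (0 : ℝ) 1) s

lemma exists_evolvesBy (hG : ContinuousOn G (Icc 0 1)) :
    ∃ U : ℝ → A, EvolvesBy G U := by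
  obtain ⟨X, h0, h⟩ := exists_solution_linearODE (F := fun s => -Complex.I • G s)
    (continuousOn_const (c := -Complex.I) |>.fun_smul hG)
  exact ⟨X, h0, fun s hs => by simpa using h s hs⟩

lemma EvolvesBy.continuousOn (hU : EvolvesBy G U) : ContinuousOn U (Icc 0 1) :=
  fun s hs => (hU.2 s hs).continuousWithinAt

lemma EvolvesBy.hasDerivWithinAt_star (hU : EvolvesBy G U) {s : ℝ} (hs : s ∈ Icc (0 : ℝ) 1)
    (hG : IsSelfAdjoint (G s)) :
    HasDerivWithinAt (fun s => star (U s)) (Complex.I • (star (U s) * G s)) (Icc (0 : ℝ) 1) s := by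
  refine (hU.2 s hs).star.congr_deriv ?_
  simp [hG.star_eq]

/-- Propagators of self-adjoint generators are unitary. -/
theorem EvolvesBy.mem_unitary (hU : EvolvesBy G U)
    (hG : ∀ s ∈ Icc (0 : ℝ) 1, IsSelfAdjoint (G s)) :
    ∀ s ∈ Icc (0 : ℝ) 1, U s ∈ unitary (A) := by
  intro s hs
  rw [Unitary.mem_iff]
  constructor
  · have h : ∀ s ∈ Icc (0 : ℝ) 1, HasDerivWithinAt (fun s => star (U s) * U s) 0 (Icc 0 1) s :=
      fun s hs => ((hU.hasDerivWithinAt_star hs (hG s hs)).mul (hU.2 s hs)).congr_deriv (by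
        simp [mul_assoc])
    have := (convex_Icc (0 : ℝ) 1).norm_image_sub_le_of_norm_hasDerivWithin_le (C := 0)
      (f' := fun _ => 0) h (by simp) (left_mem_Icc.2 zero_le_one) hs
    simpa [hU.1, sub_eq_zero] using this
  -- Unlike `U* U`, the product `U U*` has a derivative that is not visibly zero. But `U U* - 1`
  -- solves a commutator equation without source and starts at zero.
  · have h : ∀ s ∈ Icc (0 : ℝ) 1, HasDerivWithinAt (fun s => U s * star (U s) - 1)
        (Complex.I • ((fun s => - G s) s * (U s * star (U s) - 1)
          - (U s * star (U s) - 1) * (fun s => - G s) s) + 0) (Icc 0 1) s :=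
      fun s hs => (((hU.2 s hs).mul
          (hU.hasDerivWithinAt_star hs (hG s hs))).sub_const 1).congr_deriv (by
        simp only [mul_sub, sub_mul, mul_assoc, smul_mul_assoc, mul_smul_comm, neg_mul, mul_neg,
          mul_one, one_mul]
        module)
    have := norm_le_of_deriv_commutator_add (b := fun _ => 0) (b' := fun _ => 0)
      (fun s hs => (hG s hs).neg) h (by simp [hU.1]) (fun t => hasDerivAt_const _ _) (by simp) s hs
    simpa [sub_eq_zero] using this

lemma EvolvesBy.mul_star_self (hU : EvolvesBy G U)
    (hG : ∀ s ∈ Icc (0 : ℝ) 1, IsSelfAdjoint (G s)) {s : ℝ} (hs : s ∈ Icc (0 : ℝ) 1) :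
    U s * star (U s) = 1 := (Unitary.mem_iff.1 (hU.mem_unitary hG s hs)).2

/-- The Heisenberg evolution of a fixed observable. -/
lemma EvolvesBy.hasDerivWithinAt_conj (hU : EvolvesBy G U)
    {s : ℝ} (hs : s ∈ Icc (0 : ℝ) 1) (hG : IsSelfAdjoint (G s)) (B : A) :
    HasDerivWithinAt (fun s => star (U s) * B * U s)
      (Complex.I • (star (U s) * (G s * B - B * G s) * U s)) (Icc (0 : ℝ) 1) s := by
  refine (((hU.hasDerivWithinAt_star hs hG).mul_const B).mul (hU.2 s hs)).congr_deriv ?_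
  simp only [mul_sub, sub_mul, mul_assoc, smul_mul_assoc, mul_smul_comm]
  module

/-- The dependence of a propagator on its generator. -/
theorem EvolvesBy.norm_sub_le (hU : EvolvesBy G U) (hV : EvolvesBy H V)
    (hG : ∀ s ∈ Icc (0 : ℝ) 1, IsSelfAdjoint (G s))
    (hH : ∀ s ∈ Icc (0 : ℝ) 1, IsSelfAdjoint (H s)) {δ : ℝ}
    (hδ : ∀ s ∈ Icc (0 : ℝ) 1, ‖G s - H s‖ ≤ δ) : ‖U 1 - V 1‖ ≤ δ := by
  have h1 : (1 : ℝ) ∈ Icc (0 : ℝ) 1 := by simp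
  -- In the interaction picture `V* U` moves with speed exactly `‖G s - H s‖`.
  have h : ∀ s ∈ Icc (0 : ℝ) 1, HasDerivWithinAt (fun s => star (V s) * U s)
      (-Complex.I • (star (V s) * (G s - H s) * U s)) (Icc 0 1) s := fun s hs =>
    ((hV.hasDerivWithinAt_star hs (hH s hs)).mul (hU.2 s hs)).congr_deriv (by
      simp only [mul_sub, sub_mul, mul_assoc, smul_mul_assoc, mul_smul_comm]
      module)
  have := (convex_Icc (0 : ℝ) 1).norm_image_sub_le_of_norm_hasDerivWithin_le (C := δ) h
    (fun s hs => by
      rw [norm_smul, norm_neg, Complex.norm_I, one_mul,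
        CStarRing.norm_mul_mem_unitary _ (hU.mem_unitary hG s hs),
        CStarRing.norm_mem_unitary_mul _ (Unitary.star_mem (hV.mem_unitary hH s hs))]
      exact hδ s hs) (left_mem_Icc.2 zero_le_one) h1
  have e : U 1 - V 1 = V 1 * (star (V 1) * U 1 - star (V 0) * U 0) := by
    rw [hU.1, hV.1, mul_sub, ← mul_assoc, hV.mul_star_self hH h1]
    simp
  rw [e, CStarRing.norm_mem_unitary_mul _ (hV.mem_unitary hH 1 h1)]
  simpa using this

/-- If the generator takes values in a subalgebra, so does the propagator. -/
theorem EvolvesBy.mem_subalgebra (hU : EvolvesBy G U) (hG : ContinuousOn G (Icc 0 1))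
    (hGs : ∀ s ∈ Icc (0 : ℝ) 1, IsSelfAdjoint (G s))
    (S : Subalgebra ℂ A) [CompleteSpace S] (hS : ∀ s ∈ Icc (0 : ℝ) 1, G s ∈ S) : U 1 ∈ S := by
  classical
  set F : ℝ → S := fun s => if h : s ∈ Icc (0 : ℝ) 1 then -Complex.I • ⟨G s, hS s h⟩ else 0 with hF
  have hFG : ∀ s ∈ Icc (0 : ℝ) 1, (F s : A) = -Complex.I • G s := fun s hs => by
    simp only [hF, dif_pos hs]; rfl
  have hFc : ContinuousOn F (Icc 0 1) :=
    Topology.IsInducing.subtypeVal.continuousOn_iff.2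
      ((continuousOn_const (c := -Complex.I) |>.fun_smul hG).congr hFG)
  obtain ⟨X, h0, h⟩ := exists_solution_linearODE hFc
  have hV : EvolvesBy G fun s => (X s : A) := by
    refine ⟨by simp [h0], fun s hs => ?_⟩
    have h2 := (S.toSubmodule.subtypeL.restrictScalars ℝ).hasFDerivAt.comp_hasDerivWithinAt s
      (h s hs)
    refine h2.congr_deriv ?_
    have : ((F s * X s : S) : A) = -Complex.I • (G s * X s) := by
      rw [MulMemClass.coe_mul, hFG s hs, smul_mul_assoc]
    exact this
  -- Uniqueness: the solution constructed inside the complete subalgebra `S` is the given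
  -- propagator.
  have := hU.norm_sub_le hV hGs hGs (δ := 0) (by simp)
  rw [norm_le_zero_iff, sub_eq_zero] at this
  exact this ▸ (X 1).2

end Propagators

end

section

open Matrix

/-! ### Algebras of local observables and commutation at disjoint supports. -/

section Observables

variable {n d L : ℕ} [NeZero L]

/-! ### Spin observables -/

/-- The matrix of `O ⊗ 1`, with `O` acting on the sites of `X`. -/
def spinMatrix (X : Finset (Torus d L)) (O : Matrix (X → Fin n) (X → Fin n) ℂ) :
    Matrix (Torus d L → Fin n) (Torus d L → Fin n) ℂ :=
  Matrix.of fun σ τ => if ∀ x, x ∉ X → σ x = τ x then O (fun x => σ x) (fun x => τ x) else 0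

/-- The configuration that agrees with `σ` on `X` and with `τ` elsewhere. -/
def splice (X : Finset (Torus d L)) (σ τ : Torus d L → Fin n) : Torus d L → Fin n :=
  fun x => if x ∈ X then σ x else τ x

lemma spinMatrix_mul (X : Finset (Torus d L)) (O P : Matrix (X → Fin n) (X → Fin n) ℂ) :
    spinMatrix X O * spinMatrix X P = spinMatrix X (O * P) := by
  classical
  ext σ τ
  simp only [Matrix.mul_apply, spinMatrix, Matrix.of_apply]
  -- Only intermediate configurations that agree with `σ` off `X` contribute; `e` parametrizes them
  -- by their values on `X`.
  let e : (X → Fin n) → (Torus d L → Fin n) := fun ρ x => if h : x ∈ X then ρ ⟨x, h⟩ else σ x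
  have he : Function.Injective e := fun ρ ρ' h => by
    ext x
    have := congrFun h x
    simpa [e] using congrArg Fin.val this
  have hsub : ∀ ρ ∉ Finset.univ.image e, ¬ ∀ x, x ∉ X → σ x = ρ x := fun ρ hρ h => hρ <| by
    refine Finset.mem_image.2 ⟨fun x => ρ x, Finset.mem_univ _, funext fun x => ?_⟩
    by_cases hx : x ∈ X <;> simp [e, hx, h x]
  rw [← Finset.sum_subset (Finset.subset_univ (Finset.univ.image e))
    (fun ρ _ hρ => by rw [if_neg (hsub ρ hρ), zero_mul]), Finset.sum_image he.injOn]
  have h1 : ∀ ρ, (∀ x, x ∉ X → σ x = e ρ x) := fun ρ x hx => by simp [e, hx]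
  have h2 : ∀ ρ, (fun x : X => e ρ x) = ρ := fun ρ => by ext x; simp [e]
  have h3 : ∀ ρ, (∀ x, x ∉ X → e ρ x = τ x) ↔ ∀ x, x ∉ X → σ x = τ x := fun ρ =>
    forall₂_congr fun x hx => by simp [e, hx]
  simp only [if_pos (h1 _), h2, h3]
  split_ifs <;> simp

/-- A single intermediate configuration survives, namely `τ` on `X` and `σ` elsewhere. The resulting
formula is symmetric in the two factors, which gives commutation. -/
lemma spinMatrix_mul_of_disjoint {X Y : Finset (Torus d L)} (h : Disjoint X Y)
    (O : Matrix (X → Fin n) (X → Fin n) ℂ) (P : Matrix (Y → Fin n) (Y → Fin n) ℂ)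
    (σ τ : Torus d L → Fin n) :
    (spinMatrix X O * spinMatrix Y P) σ τ =
      if ∀ x, x ∉ X → x ∉ Y → σ x = τ x then
        O (fun x => σ x) (fun x => τ x) * P (fun x => σ x) (fun x => τ x) else 0 := by
  classical
  rw [Matrix.mul_apply, Finset.sum_eq_single (splice X τ σ)]
  · simp only [spinMatrix, Matrix.of_apply]
    have h1 : ∀ x, x ∉ X → σ x = splice X τ σ x := fun x hx => by simp [splice, hx]
    have h2 : (fun x : X => splice X τ σ x) = fun x : X => τ x := by ext x; simp [splice]
    have h3 : (fun x : Y => splice X τ σ x) = fun x : Y => σ x := by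
      ext x
      simp [splice, Finset.disjoint_right.1 h x.2]
    have h4 : (∀ x, x ∉ Y → splice X τ σ x = τ x) ↔ ∀ x, x ∉ X → x ∉ Y → σ x = τ x := by
      refine ⟨fun H x hx hy => by simpa [splice, hx] using H x hy, fun H x hy => ?_⟩
      by_cases hx : x ∈ X
      · simp [splice, hx]
      · simpa [splice, hx] using H x hx hy
    rw [if_pos h1, h2, h3]
    simp only [h4]
    split_ifs <;> simp
  · intro ρ _ hρ
    simp only [spinMatrix, Matrix.of_apply]
    by_cases h1 : ∀ x, x ∉ X → σ x = ρ x
    · by_cases h2 : ∀ x, x ∉ Y → ρ x = τ x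
      · refine absurd (funext fun x => ?_) hρ
        by_cases hx : x ∈ X
        · simp [splice, hx, h2 x (Finset.disjoint_left.1 h hx)]
        · simp [splice, hx, h1 x hx]
      · simp [h2]
    · simp [h1]
  · simp

lemma spinMatrix_commute {X Y : Finset (Torus d L)} (h : Disjoint X Y)
    (O : Matrix (X → Fin n) (X → Fin n) ℂ) (P : Matrix (Y → Fin n) (Y → Fin n) ℂ) :
    Commute (spinMatrix X O) (spinMatrix Y P) := by
  ext σ τ
  rw [spinMatrix_mul_of_disjoint h, spinMatrix_mul_of_disjoint h.symm]
  refine if_congr ⟨fun H x hy hx => H x hx hy, fun H x hx hy => H x hy hx⟩ (mul_comm _ _) rfl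

lemma spinMatrix_conjTranspose (X : Finset (Torus d L)) (O : Matrix (X → Fin n) (X → Fin n) ℂ) :
    (spinMatrix X O)ᴴ = spinMatrix X Oᴴ := by
  ext σ τ
  simp only [spinMatrix, Matrix.conjTranspose_apply, Matrix.of_apply, eq_comm (a := σ _)]
  split_ifs <;> simp

lemma spinMatrix_mono {X Y : Finset (Torus d L)} (h : X ⊆ Y)
    (O : Matrix (X → Fin n) (X → Fin n) ℂ) : ∃ P, spinMatrix X O = spinMatrix Y P := by
  classical
  refine ⟨Matrix.of fun σ τ => if ∀ y : Y, y.1 ∉ X → σ y = τ y then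
    O (fun x => σ ⟨x, h x.2⟩) (fun x => τ ⟨x, h x.2⟩) else 0, ?_⟩
  ext σ τ
  simp only [spinMatrix, Matrix.of_apply, ← ite_and]
  refine if_congr ⟨fun H => ⟨fun x hx => H x fun h' => hx (h h'), fun y hy => H y hy⟩,
    fun H x hx => ?_⟩ rfl rfl
  by_cases hy : x ∈ Y
  · exact H.2 ⟨x, hy⟩ hx
  · exact H.1 x hy

lemma spinMatrix_one (X : Finset (Torus d L)) :
    spinMatrix X (1 : Matrix (X → Fin n) (X → Fin n) ℂ) = 1 := by
  ext σ τ
  simp only [spinMatrix, Matrix.of_apply, Matrix.one_apply, ← ite_and]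
  refine if_congr ⟨fun H => funext fun x => ?_, fun H => by simp [H]⟩ rfl rfl
  by_cases hx : x ∈ X
  · exact congrFun H.2 ⟨x, hx⟩
  · exact H.1 x hx

lemma spinMatrix_add (X : Finset (Torus d L)) (O P : Matrix (X → Fin n) (X → Fin n) ℂ) :
    spinMatrix X O + spinMatrix X P = spinMatrix X (O + P) := by
  ext σ τ
  simp only [spinMatrix, Matrix.add_apply, Matrix.of_apply]
  split_ifs <;> simp

lemma spinMatrix_smul (X : Finset (Torus d L)) (c : ℂ) (O : Matrix (X → Fin n) (X → Fin n) ℂ) :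
    c • spinMatrix X O = spinMatrix X (c • O) := by
  ext σ τ
  simp only [spinMatrix, Matrix.smul_apply, Matrix.of_apply]
  split_ifs <;> simp

section ofMatrix

variable {sp : Species} (M N : Matrix (Label sp n d L) (Label sp n d L) ℂ)

lemma ofMatrix_mul : ofMatrix (M * N) = ofMatrix M * ofMatrix N := map_mul _ _ _

lemma ofMatrix_add : ofMatrix (M + N) = ofMatrix M + ofMatrix N := map_add _ _ _

lemma ofMatrix_smul (c : ℂ) : ofMatrix (c • M) = c • ofMatrix M := map_smul _ _ _

lemma ofMatrix_one : ofMatrix (1 : Matrix (Label sp n d L) (Label sp n d L) ℂ) = 1 := map_one _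

lemma star_ofMatrix : star (ofMatrix M) = ofMatrix Mᴴ :=
  (map_star (Matrix.toEuclideanCLM (𝕜 := ℂ) (n := Label sp n d L)) M).symm

end ofMatrix

/-- The spin observables supported in `X`, as a subalgebra. -/
def spinSubalgebra (n : ℕ) (X : Finset (Torus d L)) : Subalgebra ℂ (Op .spin n d L) where
  carrier := spinAlg X
  mul_mem' := by
    rintro _ _ ⟨O, rfl⟩ ⟨P, rfl⟩
    exact ⟨O * P, by
      rw [← ofMatrix_mul]; exact congrArg _ (spinMatrix_mul X O P)⟩
  add_mem' := by
    rintro _ _ ⟨O, rfl⟩ ⟨P, rfl⟩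
    exact ⟨O + P, by
      rw [← ofMatrix_add]; exact congrArg _ (spinMatrix_add X O P)⟩
  algebraMap_mem' c := ⟨c • 1, by
    rw [Algebra.algebraMap_eq_smul_one, ← ofMatrix_one, ← ofMatrix_smul]
    refine congrArg _ ?_
    have := spinMatrix_smul X c (1 : Matrix (X → Fin n) (X → Fin n) ℂ)
    rw [spinMatrix_one] at this
    exact this⟩

/-! ### Fermionic observables -/

/-- The matrix of the annihilation operator of the mode `j`. -/
noncomputable def annihilateMatrix (j : Torus d L × Fin n) :
    Matrix (Finset (Torus d L × Fin n)) (Finset (Torus d L × Fin n)) ℂ :=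
  Matrix.of fun S T => if j ∈ T ∧ S = T.erase j then (-1 : ℂ) ^ precede T j else 0

lemma annihilateMatrix_col (j : Torus d L × Fin n) (T : Finset (Torus d L × Fin n)) :
    (annihilateMatrix j).col T =
      if j ∈ T then (-1 : ℂ) ^ precede T j • Pi.single (T.erase j) 1 else 0 := by
  ext S
  by_cases hj : j ∈ T
  · by_cases hS : S = T.erase j
    · simp [annihilateMatrix, hj, hS]
    · simp [annihilateMatrix, hj, hS]
  · simp [annihilateMatrix, hj]

lemma precede_insert_self (T : Finset (Torus d L × Fin n)) (j : Torus d L × Fin n) :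
    precede (insert j T) j = precede T j := by
  simp [precede, Finset.filter_insert]

lemma annihilateMatrix_conjTranspose_col (j : Torus d L × Fin n)
    (T : Finset (Torus d L × Fin n)) :
    (annihilateMatrix j)ᴴ.col T =
      if j ∈ T then 0 else (-1 : ℂ) ^ precede T j • Pi.single (insert j T) 1 := by
  ext S
  have hiff : (j ∈ S ∧ T = S.erase j) ↔ (j ∉ T ∧ S = insert j T) := by
    constructor
    · rintro ⟨h, rfl⟩; simp [h]
    · rintro ⟨h, rfl⟩; simp [h]
  simp only [annihilateMatrix, Matrix.col_apply, Matrix.conjTranspose_apply, Matrix.of_apply, hiff]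
  by_cases hj : j ∈ T
  · simp [hj]
  · by_cases hS : S = insert j T
    · subst hS; simp [hj, precede_insert_self]
    · simp [hj, hS]

lemma precede_insert {T : Finset (Torus d L × Fin n)} {i j : Torus d L × Fin n} (hi : i ∉ T) :
    precede (insert i T) j = precede T j + if Fintype.equivFin (Torus d L × Fin n) i <
      Fintype.equivFin (Torus d L × Fin n) j then 1 else 0 := by
  unfold precede
  rw [Finset.filter_insert]
  split_ifs with h
  · rw [Finset.card_insert_of_notMem (by simp [hi])]
  · rfl

lemma precede_erase {T : Finset (Torus d L × Fin n)} {i j : Torus d L × Fin n} (hi : i ∈ T) :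
    precede T j = precede (T.erase i) j + if Fintype.equivFin (Torus d L × Fin n) i <
      Fintype.equivFin (Torus d L × Fin n) j then 1 else 0 := by
  conv_lhs => rw [← Finset.insert_erase hi]
  exact precede_insert (by simp)

lemma equivFin_lt_or {i j : Torus d L × Fin n} (h : i ≠ j) :
    (Fintype.equivFin (Torus d L × Fin n) i < Fintype.equivFin (Torus d L × Fin n) j ∧
      ¬ Fintype.equivFin (Torus d L × Fin n) j < Fintype.equivFin (Torus d L × Fin n) i) ∨
    (Fintype.equivFin (Torus d L × Fin n) j < Fintype.equivFin (Torus d L × Fin n) i ∧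
      ¬ Fintype.equivFin (Torus d L × Fin n) i < Fintype.equivFin (Torus d L × Fin n) j) := by
  rcases lt_or_gt_of_ne ((Fintype.equivFin (Torus d L × Fin n)).injective.ne h) with h | h
  · exact .inl ⟨h, h.asymm⟩
  · exact .inr ⟨h, h.asymm⟩

/-- Both orders of removal reach the same set. Removing one mode shifts the count of modes preceding
the other only if it comes earlier, so exactly one of the two orders picks up an extra sign. -/
lemma annihilateMatrix_anticomm {i j : Torus d L × Fin n} (h : i ≠ j) :
    annihilateMatrix i * annihilateMatrix j = - (annihilateMatrix j * annihilateMatrix i) := by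
  refine Matrix.ext_of_mulVec_single fun T => ?_
  rw [Matrix.neg_mulVec, ← Matrix.mulVec_mulVec, ← Matrix.mulVec_mulVec]
  by_cases hi : i ∈ T <;> by_cases hj : j ∈ T <;>
    simp [annihilateMatrix_col, hi, hj, Matrix.mulVec_smul, h, h.symm]
  rw [precede_erase (j := i) hj, precede_erase (j := j) hi, Finset.erase_right_comm, smul_smul,
    smul_smul, ← neg_smul]
  congr 1
  rcases equivFin_lt_or h with ⟨h1, h2⟩ | ⟨h1, h2⟩ <;> simp [h1, h2] <;> ring

lemma annihilateMatrix_conjTranspose_anticomm {i j : Torus d L × Fin n} (h : i ≠ j) :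
    annihilateMatrix i * (annihilateMatrix j)ᴴ = - ((annihilateMatrix j)ᴴ * annihilateMatrix i) := by
  refine Matrix.ext_of_mulVec_single fun T => ?_
  rw [Matrix.neg_mulVec, ← Matrix.mulVec_mulVec, ← Matrix.mulVec_mulVec]
  by_cases hi : i ∈ T <;> by_cases hj : j ∈ T <;>
    simp [annihilateMatrix_col, annihilateMatrix_conjTranspose_col, hi, hj,
      Matrix.mulVec_smul, h, h.symm]
  rw [precede_insert (j := i) hj, precede_erase (j := j) hi,
    Finset.erase_insert_of_ne h.symm, smul_smul, smul_smul, ← neg_smul]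
  congr 1
  rcases equivFin_lt_or h with ⟨h1, h2⟩ | ⟨h1, h2⟩ <;> simp [h1, h2] <;> ring

lemma fermiGenerators_star {X : Finset (Torus d L)} {a : Op .fermion n d L}
    (ha : a ∈ fermiGenerators X) : star a ∈ fermiGenerators X := by
  obtain ⟨j, hj, rfl | rfl⟩ := ha
  · exact ⟨j, hj, .inr rfl⟩
  · exact ⟨j, hj, .inl (star_star _)⟩

lemma annihilate_anticomm {i j : Torus d L × Fin n} (h : i ≠ j) :
    annihilate i * annihilate j = - (annihilate j * annihilate i) := by
  have := congrArg (ofMatrix (sp := .fermion)) (annihilateMatrix_anticomm h)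
  rw [← neg_one_smul ℂ] at this ⊢
  exact (ofMatrix_mul _ _).symm.trans (this.trans ((ofMatrix_smul _ _).trans
    (congrArg _ (ofMatrix_mul _ _))))

lemma annihilate_star_anticomm {i j : Torus d L × Fin n} (h : i ≠ j) :
    annihilate i * star (annihilate j) = - (star (annihilate j) * annihilate i) := by
  have := congrArg (ofMatrix (sp := .fermion)) (annihilateMatrix_conjTranspose_anticomm h)
  have e : star (annihilate j) = ofMatrix (sp := .fermion) (annihilateMatrix j)ᴴ := star_ofMatrix _
  rw [← neg_one_smul ℂ] at this ⊢
  rw [e]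
  exact (ofMatrix_mul _ _).symm.trans (this.trans ((ofMatrix_smul _ _).trans
    (congrArg _ (ofMatrix_mul _ _))))

lemma star_anticomm {A : Type*} [CStarAlgebra A] {a b : A} (h : a * b = - (b * a)) :
    star b * star a = - (star a * star b) := by
  rw [← star_mul, h, star_neg, star_mul]

/-- Generators at disjoint sets of sites anticommute. -/
lemma fermiGenerators_anticomm {X Y : Finset (Torus d L)} (h : Disjoint X Y)
    {a b : Op .fermion n d L} (ha : a ∈ fermiGenerators X) (hb : b ∈ fermiGenerators Y) :
    a * b = - (b * a) := by
  obtain ⟨i, hi, hai⟩ := ha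
  obtain ⟨j, hj, hbj⟩ := hb
  have hij : i ≠ j := fun e => Finset.disjoint_left.1 h hi (e ▸ hj)
  rcases hai with rfl | rfl <;> rcases hbj with rfl | rfl
  · exact annihilate_anticomm hij
  · exact annihilate_star_anticomm hij
  · rw [annihilate_star_anticomm hij.symm, neg_neg]
  · exact star_anticomm (annihilate_anticomm hij.symm)

lemma list_prod_anticomm {A : Type*} [Ring A] (a : A) (l : List A)
    (h : ∀ b ∈ l, a * b = - (b * a)) : a * l.prod = (-1) ^ l.length * (l.prod * a) := by
  induction l with
  | nil => simp
  | cons b l ih =>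
    have h1 := ih fun c hc => h c (List.mem_cons_of_mem _ hc)
    rw [List.prod_cons, List.length_cons, ← mul_assoc, h b List.mem_cons_self, neg_mul, mul_assoc,
      h1, ← mul_assoc b, ← ((Commute.neg_one_left b).pow_left _).eq, pow_succ']
    simp only [mul_assoc, neg_mul, one_mul]

lemma fermiAlg_commute {X Y : Finset (Torus d L)} (h : Disjoint X Y) {A B : Op .fermion n d L}
    (hA : A ∈ fermiAlg X) (hB : B ∈ fermiAlg Y) : Commute A B := by
  refine Algebra.commute_of_mem_adjoin_of_forall_mem_commute hB ?_
  rintro _ ⟨l, hl, hle, rfl⟩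
  refine (Algebra.commute_of_mem_adjoin_of_forall_mem_commute hA ?_).symm
  rintro _ ⟨m, hm, -, rfl⟩
  refine Commute.list_prod_right _ _ fun a ha => ?_
  -- Each single generator of the other monomial passes the even product `l` with sign `+1`, so the
  -- parity of one factor suffices.
  have := list_prod_anticomm a l fun b hb =>
    fermiGenerators_anticomm h (hm a ha) (hl b hb)
  exact (this.trans ((congrArg (· * (l.prod * a)) hle.neg_one_pow).trans (one_mul _))).symm

lemma fermiAlg_star {X : Finset (Torus d L)} {A : Op .fermion n d L} (hA : A ∈ fermiAlg X) :
    star A ∈ fermiAlg X := by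
  refine Algebra.adjoin_induction (p := fun A _ => star A ∈ fermiAlg X) ?_ ?_ ?_ ?_ hA
  · rintro _ ⟨l, hl, hle, rfl⟩
    refine Algebra.subset_adjoin ⟨(l.map star).reverse, ?_, by simpa using hle, ?_⟩
    · intro a ha
      obtain ⟨b, hb, rfl⟩ := List.mem_map.1 (List.mem_reverse.1 ha)
      exact fermiGenerators_star (hl b hb)
    · clear hl hle
      induction l with
      | nil => simp
      | cons a l ih => simp [ih]
  · intro r
    rw [← algebraMap_star_comm]
    exact Subalgebra.algebraMap_mem _ _
  · intro x y _ _ hx hy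
    exact (star_add x y : star (x + y) = _) ▸ Subalgebra.add_mem _ hx hy
  · intro x y _ _ hx hy
    exact (star_mul x y : star (x * y) = _) ▸ Subalgebra.mul_mem _ hy hx

/-! ### Local observables -/

/-- The observables supported in `X`, as a subalgebra. -/
noncomputable def localSubalgebra (sp : Species) (n : ℕ) (X : Finset (Torus d L)) :
    Subalgebra ℂ (Op sp n d L) :=
  match sp with
  | .spin => spinSubalgebra n X
  | .fermion => Algebra.adjoin ℂ {A : Op .fermion n d L | ∃ l : List (Op .fermion n d L),
    (∀ a ∈ l, a ∈ fermiGenerators X) ∧ Even l.length ∧ A = l.prod}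

variable {sp : Species} {X Y : Finset (Torus d L)} {A B : Op sp n d L}

lemma mem_localSubalgebra : A ∈ localSubalgebra sp n X ↔ A ∈ localAlg sp X := by
  cases sp <;> exact Iff.rfl

/-- Observables with disjoint supports commute. -/
theorem localAlg_commute (h : Disjoint X Y) (hA : A ∈ localAlg sp X) (hB : B ∈ localAlg sp Y) :
    Commute A B := by
  cases sp with
  | spin =>
    obtain ⟨O, rfl⟩ := hA
    obtain ⟨P, rfl⟩ := hB
    exact (ofMatrix_mul _ _).symm.trans ((congrArg _ (spinMatrix_commute h O P)).trans
      (ofMatrix_mul _ _))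
  | fermion => exact fermiAlg_commute h hA hB

lemma localAlg_star (hA : A ∈ localAlg sp X) : star A ∈ localAlg sp X := by
  cases sp with
  | spin =>
    obtain ⟨O, rfl⟩ := hA
    exact ⟨Oᴴ, (star_ofMatrix _).trans (congrArg _ (spinMatrix_conjTranspose X O))⟩
  | fermion => exact fermiAlg_star hA

lemma localAlg_mono (h : X ⊆ Y) : localAlg sp X ⊆ (localAlg sp Y : Set (Op sp n d L)) := by
  cases sp with
  | spin =>
    rintro _ ⟨O, rfl⟩
    obtain ⟨P, hP⟩ := spinMatrix_mono h O
    exact ⟨P, congrArg _ hP⟩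
  | fermion =>
    refine Algebra.adjoin_mono ?_
    rintro _ ⟨l, hl, hle, rfl⟩
    refine ⟨l, fun a ha => ?_, hle, rfl⟩
    obtain ⟨j, hj, e⟩ := hl a ha
    exact ⟨j, h hj, e⟩

lemma charge_mem_localSubalgebra {Q : Torus d L → Op sp n d L} (hQ : IsLocalCharge Q)
    (X : Finset (Torus d L)) : charge Q X ∈ localSubalgebra sp n X :=
  Subalgebra.sum_mem _ fun x hx => mem_localSubalgebra.2
    (localAlg_mono (Finset.singleton_subset_iff.2 hx) (hQ.mem x))

lemma IsLocalCharge.selfAdjoint_charge {Q : Torus d L → Op sp n d L} (hQ : IsLocalCharge Q)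
    (X : Finset (Torus d L)) : IsSelfAdjoint (charge Q X) :=
  isSelfAdjoint_sum (R := Op sp n d L) _ fun x _ => hQ.selfAdjoint x

end Observables

/-- Commuting self-adjoint elements with integer spectrum have a sum `q` with `exp (2πi q) = 1`. -/
theorem exp_sum_eq_one_of_spectrum_int {A : Type*} [CStarAlgebra A] {ι : Type*} (s : Finset ι)
    (q : ι → A) (hq : ∀ i, IsSelfAdjoint (q i))
    (hi : ∀ i, spectrum ℂ (q i) ⊆ Set.range fun k : ℤ => (k : ℂ))
    (hc : ∀ i j, i ≠ j → Commute (q i) (q j)) :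
    NormedSpace.exp ((2 * (Real.pi : ℂ) * Complex.I) • ∑ i ∈ s, q i) = 1 := by
  let : NormedAlgebra ℚ A := .restrictScalars ℚ ℝ A
  have h1 : ∀ i, NormedSpace.exp ((2 * (Real.pi : ℂ) * Complex.I) • q i) = 1 := fun i => by
    have := (hq i).isStarNormal
    have hn : IsStarNormal ((2 * (Real.pi : ℂ) * Complex.I) • q i) := inferInstance
    -- By the functional calculus it suffices that `z ↦ exp z` equals 1 on the spectrum, which
    -- consists of points `2πik` with `k` an integer.
    rw [← CFC.exp_eq_normedSpace_exp (𝕜 := ℂ) hn, ← cfc_one ℂ ((2 * (Real.pi : ℂ) * Complex.I) • q i)]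
    refine cfc_congr fun z hz => ?_
    have h0 : (2 * (Real.pi : ℂ) * Complex.I) ≠ 0 := Complex.two_pi_I_ne_zero
    rw [show (2 * (Real.pi : ℂ) * Complex.I) • q i = Units.mk0 _ h0 • q i from rfl,
      spectrum.unit_smul_eq_smul] at hz
    obtain ⟨w, hw, rfl⟩ := hz
    obtain ⟨k, rfl⟩ := hi i hw
    rw [← Complex.exp_eq_exp_ℂ]
    simpa [mul_comm, Units.smul_def] using Complex.exp_int_mul_two_pi_mul_I k
  rw [Finset.smul_sum, NormedSpace.exp_sum_of_commute s _
    fun i _ j _ hij => ((hc i j hij).smul_left _).smul_right _]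
  exact Finset.noncommProd_induction _ _ _ (· = 1) (fun a b ha hb => by simp [ha, hb]) rfl
    fun i _ => h1 i

/-- The charge of a region has integer spectrum, in exponential form. -/
theorem IsLocalCharge.exp_charge {sp : Species} {n d L : ℕ} [NeZero L]
    {Q : Torus d L → Op sp n d L} (hQ : IsLocalCharge Q) (X : Finset (Torus d L)) :
    NormedSpace.exp ((2 * (Real.pi : ℂ) * Complex.I) • charge Q X) = 1 :=
  exp_sum_eq_one_of_spectrum_int X Q hQ.selfAdjoint hQ.integer fun x y hxy =>
    localAlg_commute (by simpa using hxy) (hQ.mem x) (hQ.mem y)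

end

/-! ### Geometry of the torus: circular distance, balls, boundary strips. -/

section Torus

variable {d L : ℕ}

lemma circ_add_le (a b : ZMod L) :
    (a + b).valMinAbs.natAbs ≤ a.valMinAbs.natAbs + b.valMinAbs.natAbs :=
  (ZMod.natAbs_valMinAbs_add_le a b).trans (Int.natAbs_add_le _ _)

lemma circ_sub_comm (a b : ZMod L) : (a - b).valMinAbs.natAbs = (b - a).valMinAbs.natAbs := by
  rw [← neg_sub, ZMod.natAbs_valMinAbs_neg]

lemma circ_sub_le (a b c : ZMod L) :
    (a - c).valMinAbs.natAbs ≤ (a - b).valMinAbs.natAbs + (b - c).valMinAbs.natAbs := by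
  simpa using circ_add_le (a - b) (b - c)

/-- `valMinAbs` is the representative of least absolute value. This turns estimates on integers into
estimates on the circle. -/
lemma circ_intCast_le [NeZero L] (k : ℤ) : (k : ZMod L).valMinAbs.natAbs ≤ k.natAbs :=
  ZMod.natAbs_min_of_le_div_two L _ _ (by simp) (ZMod.natAbs_valMinAbs_le _)

@[simp] lemma tdist_self (x : Torus d L) : tdist x x = 0 := by simp [tdist]

lemma tdist_triangle (x y z : Torus d L) : tdist x z ≤ tdist x y + tdist y z := by
  rw [tdist, tdist, tdist, ← Finset.sum_add_distrib]
  exact Finset.sum_le_sum fun _ _ => circ_sub_le _ _ _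

lemma circ_le_tdist (x y : Torus d L) (i : Fin d) :
    (x i - y i).valMinAbs.natAbs ≤ tdist x y :=
  Finset.single_le_sum (f := fun i => (x i - y i).valMinAbs.natAbs) (fun _ _ => Nat.zero_le _)
    (Finset.mem_univ i)

lemma tdist_le_diam {X : Finset (Torus d L)} {x y : Torus d L} (hx : x ∈ X) (hy : y ∈ X) :
    tdist x y ≤ diam X :=
  (Finset.le_sup (f := fun y => tdist x y) hy).trans
    (Finset.le_sup (f := fun x => X.sup fun y => tdist x y) hx)

lemma diam_empty : diam (∅ : Finset (Torus d L)) = 0 := rfl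

variable [NeZero L]

lemma card_ball_le (x : Torus d L) (R : ℕ) :
    (Finset.univ.filter fun y => tdist x y ≤ R).card ≤ (2 * R + 1) ^ d := by
  classical
  have h : (Finset.univ.filter fun y => tdist x y ≤ R).card ≤
      (Fintype.piFinset fun _ : Fin d => Finset.Icc (-(R : ℤ)) R).card := by
    refine Finset.card_le_card_of_injOn (fun y i => (x i - y i).valMinAbs) (fun y hy => ?_) ?_
    · have hy : tdist x y ≤ R := by simpa using hy
      simp only [Finset.mem_coe, Fintype.mem_piFinset, Finset.mem_Icc]
      intro i
      have := (circ_le_tdist x y i).trans hy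
      omega
    · intro y _ z _ hyz
      ext i
      have := congrFun hyz i
      exact sub_right_injective (ZMod.injective_valMinAbs this)
  refine h.trans_eq ?_
  rw [Fintype.card_piFinset]
  simp only [Int.card_Icc, Finset.prod_const, Finset.card_univ, Fintype.card_fin]
  congr 1
  omega

lemma subset_ball {X : Finset (Torus d L)} {x : Torus d L} {R : ℕ} (hx : x ∈ X)
    (hX : diam X ≤ R) : X ⊆ Finset.univ.filter fun y => tdist x y ≤ R := fun y hy => by
  simpa using (tdist_le_diam hx hy).trans hX

lemma card_le_of_diam_le {X : Finset (Torus d L)} {R : ℕ} (hX : diam X ≤ R) :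
    X.card ≤ (2 * R + 1) ^ d := by
  rcases X.eq_empty_or_nonempty with rfl | ⟨x, hx⟩
  · simp
  · exact (Finset.card_le_card (subset_ball hx hX)).trans (card_ball_le x R)

lemma card_filter_mem_diam_le (x : Torus d L) (R : ℕ) :
    (Finset.univ.filter fun X : Finset (Torus d L) => x ∈ X ∧ diam X ≤ R).card ≤
      2 ^ ((2 * R + 1) ^ d) := by
  calc _ ≤ (Finset.univ.filter fun y => tdist x y ≤ R).powerset.card :=
        Finset.card_le_card fun X hX => by
          rw [Finset.mem_filter] at hX
          exact Finset.mem_powerset.2 (subset_ball hX.2.1 hX.2.2)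
    _ ≤ _ := by
        rw [Finset.card_powerset]
        exact Nat.pow_le_pow_right (by norm_num) (card_ball_le x R)

lemma card_torus : Fintype.card (Torus d L) = L ^ d := by simp [ZMod.card]

variable [NeZero d]

/-- A nearest point of the hyperplane is reached by changing the first coordinate alone. All strip
geometry thus becomes one-dimensional. -/
lemma mem_fatten_hyperplane {c : ZMod L} {x : Torus d L} {r : ℕ} :
    x ∈ fatten (Finset.univ.filter fun x : Torus d L => x 0 = c) r ↔
      (x 0 - c).valMinAbs.natAbs ≤ r := by
  classical
  simp only [fatten, Finset.mem_filter, Finset.mem_univ, true_and]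
  constructor
  · rintro ⟨y, hy, h⟩
    exact hy ▸ (circ_le_tdist x y 0).trans h
  · intro h
    refine ⟨Function.update x 0 c, by simp, ?_⟩
    rw [tdist, Finset.sum_eq_single 0]
    · simpa using h
    · intro i _ hi
      simp [hi]
    · simp

lemma mem_fatten_bdryMinus {x : Torus d L} {r : ℕ} :
    x ∈ fatten (bdryMinus d L) r ↔ (x 0).valMinAbs.natAbs ≤ r := by
  rw [bdryMinus, mem_fatten_hyperplane, sub_zero]

lemma mem_fatten_bdryPlus {x : Torus d L} {r : ℕ} :
    x ∈ fatten (bdryPlus d L) r ↔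
      (x 0 - (((L / 2 : ℕ) : ZMod L) - 1)).valMinAbs.natAbs ≤ r := by
  rw [bdryPlus, mem_fatten_hyperplane]

lemma fatten_bdryMinus_subset_strip : fatten (bdryMinus d L) (L / 12) ⊆ stripMinus d L := by
  intro x hx
  rw [mem_fatten_bdryMinus] at hx
  simp only [stripMinus, Finset.mem_filter, Finset.mem_univ, true_and, Int.abs_eq_natAbs]
  omega

/-- `∂₊` sits at `L/2 - 1` but `S₊` is centred at `L/2`. The shift by one requires `8 * (L / 12 + 1)
≤ L`, which holds for all `L ≥ 16`. -/
lemma fatten_bdryPlus_subset_strip (hL : 16 ≤ L) :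
    fatten (bdryPlus d L) (L / 12) ⊆ stripPlus d L := by
  intro x hx
  rw [mem_fatten_bdryPlus] at hx
  simp only [stripPlus, Finset.mem_filter, Finset.mem_univ, true_and, Int.abs_eq_natAbs]
  have h1 := circ_sub_le (x 0) (((L / 2 : ℕ) : ZMod L) - 1) ((L / 2 : ℕ) : ZMod L)
  have h2 : ((((L / 2 : ℕ) : ZMod L) - 1) - ((L / 2 : ℕ) : ZMod L)).valMinAbs.natAbs ≤ 1 := by
    have := circ_intCast_le (L := L) (-1)
    simpa using this
  omega

/-- The two boundaries are far apart. -/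
lemma not_mem_fatten_both {x : Torus d L} {r r' : ℕ} (h : r + r' + 1 < L / 2)
    (h1 : x ∈ fatten (bdryMinus d L) r) (h2 : x ∈ fatten (bdryPlus d L) r') : False := by
  rw [mem_fatten_bdryMinus] at h1
  rw [mem_fatten_bdryPlus] at h2
  have h3 := circ_sub_le (((L / 2 : ℕ) : ZMod L) - 1) (x 0) 0
  rw [circ_sub_comm] at h3
  have h4 : ((((L / 2 : ℕ) : ZMod L) - 1) - 0) = ((L / 2 - 1 : ℕ) : ZMod L) := by
    rw [Nat.cast_sub (by omega)]; simp
  rw [circ_sub_comm 0, h4, ZMod.valMinAbs_natCast_of_le_half (by omega), sub_zero,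
    circ_sub_comm] at h3
  omega

/-- A set of small diameter that meets both the half-torus and its complement is close to one of
the two boundaries. -/
lemma subset_fatten_of_straddle {X : Finset (Torus d L)} {R : ℕ} (hX : diam X ≤ R) (heven : Even L)
    {x y : Torus d L} (hx : x ∈ X) (hy : y ∈ X) (hxΓ : x ∈ halfTorus d L)
    (hyΓ : y ∉ halfTorus d L) :
    X ⊆ fatten (bdryMinus d L) (2 * R) ∨ X ⊆ fatten (bdryPlus d L) (2 * R) := by
  have hR : ((x 0 - y 0).valMinAbs).natAbs ≤ R :=
    (circ_le_tdist x y 0).trans ((tdist_le_diam hx hy).trans hX)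
  have hL : 0 < L := NeZero.pos L
  rw [halfTorus, Finset.mem_filter, coord] at hxΓ hyΓ
  simp only [Finset.mem_univ, true_and] at hxΓ hyΓ
  obtain ⟨m, rfl⟩ := heven
  set a := (x 0).valMinAbs with ha
  set b := (y 0).valMinAbs with hb
  set c := (x 0 - y 0).valMinAbs with hc
  have hb1 := ZMod.valMinAbs_mem_Ioc (y 0)
  have hc1 := ZMod.valMinAbs_mem_Ioc (x 0 - y 0)
  rw [← hb, Set.mem_Ioc] at hb1
  rw [← hc, Set.mem_Ioc] at hc1
  -- The circular difference `c` and the integer difference `a - b` agree up to a multiple of the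
  -- side length. The ranges of the representatives leave only the multiples -1, 0 and 1.
  have hcong : ((c : ℤ) : ZMod (m + m)) = ((a - b : ℤ) : ZMod (m + m)) := by
    rw [hc, ha, hb]; push_cast; simp
  obtain ⟨k, hk⟩ := (ZMod.intCast_eq_intCast_iff_dvd_sub _ _ _).1 hcong
  have hm : 0 < m := by omega
  push_cast at *
  have key : a.natAbs ≤ R ∨ (a - ((m : ℤ) - 1)).natAbs ≤ R := by
    have hk1 : -2 < k := by nlinarith
    have hk2 : k < 2 := by nlinarith
    have : k = -1 ∨ k = 0 ∨ k = 1 := by omega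
    rcases this with rfl | rfl | rfl <;> omega
  -- One `R` brings `x` to the boundary and a second one reaches the other points of `X` from `x`,
  -- hence `2 * R`.
  have tri : ∀ e : ZMod (m + m), (x 0 - e).valMinAbs.natAbs ≤ R →
      ∀ z ∈ X, (z 0 - e).valMinAbs.natAbs ≤ 2 * R := fun e he z hz => by
    have h1 := circ_sub_le (z 0) (x 0) e
    have h2 := (circ_le_tdist z x 0).trans ((tdist_le_diam hz hx).trans hX)
    omega
  rcases key with h | h
  · refine .inl fun z hz => mem_fatten_bdryMinus.2 ?_
    simpa using tri 0 (by simpa using h) z hz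
  · refine .inr fun z hz => mem_fatten_bdryPlus.2 (tri _ ?_ z hz)
    have h3 := circ_intCast_le (L := m + m) (a - ((m : ℤ) - 1))
    have h4 : ((a - ((m : ℤ) - 1) : ℤ) : ZMod (m + m)) =
        x 0 - ((((m + m) / 2 : ℕ) : ZMod (m + m)) - 1) := by
      rw [show (m + m) / 2 = m by omega, ha]; push_cast; simp
    rw [h4] at h3
    exact h3.trans h

end Torus

section

open Set

/-! ### Comparison of Heisenberg evolutions. -/

section Generic

variable {A : Type*} [CStarAlgebra A]

lemma norm_commutator_le (a b : A) : ‖a * b - b * a‖ ≤ 2 * ‖a‖ * ‖b‖ := by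
  calc ‖a * b - b * a‖ ≤ ‖a * b‖ + ‖b * a‖ := norm_sub_le _ _
    _ ≤ ‖a‖ * ‖b‖ + ‖b‖ * ‖a‖ := add_le_add (norm_mul_le _ _) (norm_mul_le _ _)
    _ = _ := by ring

lemma norm_sum_commutator_le {ι : Type*} (s : Finset ι) (f : ι → A) (b : A) :
    ‖(∑ i ∈ s, f i) * b - b * ∑ i ∈ s, f i‖ ≤ ∑ i ∈ s, ‖f i * b - b * f i‖ := by
  rw [Finset.sum_mul, Finset.mul_sum, ← Finset.sum_sub_distrib]
  exact norm_sum_le _ _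

/-- Jacobi identity: since `[C, K] = 0`, the `K` part acts on `[C, B]` by a commutator and so does
not affect the growth of its norm. -/
lemma commutator_split {C K N B : A} (h : Commute C K) :
    C * (Complex.I • ((K + N) * B - B * (K + N))) - Complex.I • ((K + N) * B - B * (K + N)) * C =
      Complex.I • (K * (C * B - B * C) - (C * B - B * C) * K) +
        Complex.I • (C * (N * B - B * N) - (N * B - B * N) * C) := by
  rw [mul_smul_comm, smul_mul_assoc, ← smul_sub, ← smul_add]
  congr 1
  have h1 : C * (K * B) = K * (C * B) := by rw [← mul_assoc, h.eq, mul_assoc]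
  simp only [mul_add, add_mul, mul_sub, sub_mul, mul_assoc, h1, h.eq]
  abel

/-- The growth of a commutator with an evolving observable is governed by the terms of the
generator that do not commute with the fixed observable. -/
lemma norm_commutator_le_of_deriv {B K N : ℝ → A} {C : A} {T : ℝ} {b b' : ℝ → ℝ}
    (hK : ∀ t ∈ Icc 0 T, IsSelfAdjoint (K t)) (hC : ∀ t ∈ Icc 0 T, Commute C (K t))
    (hB : ∀ t ∈ Icc 0 T, HasDerivWithinAt B
      (Complex.I • ((K t + N t) * B t - B t * (K t + N t))) (Icc 0 T) t)
    (h0 : ‖C * B 0 - B 0 * C‖ ≤ b 0) (hb : ∀ t, HasDerivAt b (b' t) t)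
    (hN : ∀ t ∈ Icc 0 T, 2 * ‖C‖ * ‖N t * B t - B t * N t‖ ≤ b' t) :
    ∀ t ∈ Icc 0 T, ‖C * B t - B t * C‖ ≤ b t := by
  refine norm_le_of_deriv_commutator_add (D := fun t => C * B t - B t * C)
    (E := fun t => Complex.I • (C * (N t * B t - B t * N t) - (N t * B t - B t * N t) * C))
    hK (fun t ht => ?_) h0 hb fun t ht => ?_
  · exact (((hB t ht).const_mul C).sub ((hB t ht).mul_const C)).congr_deriv
      (commutator_split (hC t ht))
  · rw [norm_smul, Complex.norm_I, one_mul]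
    exact (norm_commutator_le _ _).trans (hN t ht)

variable {G H U V : ℝ → A}

lemma EvolvesBy.norm_conj {a : A} (hU : EvolvesBy G U)
    (hG : ∀ s ∈ Icc (0 : ℝ) 1, IsSelfAdjoint (G s)) {s : ℝ} (hs : s ∈ Icc (0 : ℝ) 1) :
    ‖star (U s) * a * U s‖ = ‖a‖ := by
  rw [CStarRing.norm_mul_mem_unitary _ (hU.mem_unitary hG s hs),
    CStarRing.norm_mem_unitary_mul _ (Unitary.star_mem (hU.mem_unitary hG s hs))]

/-- The backwards evolution `V(r) B V(r)*` of an observable. -/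
lemma EvolvesBy.hasDerivWithinAt_conj_star (hV : EvolvesBy H V)
    {r : ℝ} (hr : r ∈ Icc (0 : ℝ) 1) (hH : IsSelfAdjoint (H r)) (B : A) :
    HasDerivWithinAt (fun r => V r * B * star (V r))
      (-Complex.I • (H r * (V r * B * star (V r)) - V r * B * star (V r) * H r))
      (Icc (0 : ℝ) 1) r := by
  refine (((hV.2 r hr).mul_const B).mul (hV.hasDerivWithinAt_star hr hH)).congr_deriv ?_
  simp only [mul_assoc, smul_mul_assoc, mul_smul_comm]
  module

/-- Reversing time from `s` gives the sign of a Heisenberg equation. With `B = V(s)* A V(s)` the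
initial value is the local observable `A`, as `lieb_robinson` requires. -/
lemma EvolvesBy.hasDerivWithinAt_reversed (hV : EvolvesBy H V)
    (hH : ∀ s ∈ Icc (0 : ℝ) 1, IsSelfAdjoint (H s)) {s : ℝ} (hs : s ∈ Icc (0 : ℝ) 1) (B : A) :
    ∀ t ∈ Icc 0 s, HasDerivWithinAt (fun t => V (s - t) * B * star (V (s - t)))
      (Complex.I • (H (s - t) * (V (s - t) * B * star (V (s - t)))
        - V (s - t) * B * star (V (s - t)) * H (s - t))) (Icc 0 s) t := by
  intro t ht
  have hr : s - t ∈ Icc (0 : ℝ) 1 := ⟨by linarith [ht.2], by linarith [ht.1, hs.2]⟩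
  have h1 : HasDerivWithinAt (fun t => s - t) (-1) (Icc 0 s) t :=
    (hasDerivWithinAt_id t _).const_sub s
  have h2 := (hV.hasDerivWithinAt_conj_star hr (hH _ hr) B).scomp t h1
    fun u hu => ⟨by linarith [hu.2], by linarith [hu.1, hs.2]⟩
  refine h2.congr_deriv ?_
  module

/-- Comparison of two Heisenberg evolutions. -/
lemma EvolvesBy.norm_conj_sub_conj_le (hU : EvolvesBy G U) (hV : EvolvesBy H V)
    (hG : ∀ s ∈ Icc (0 : ℝ) 1, IsSelfAdjoint (G s))
    (hH : ∀ s ∈ Icc (0 : ℝ) 1, IsSelfAdjoint (H s)) {s : ℝ} (hs : s ∈ Icc (0 : ℝ) 1) {a : A}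
    {B : ℝ → A} (hB : ∀ r, B r = V r * (star (V s) * a * V s) * star (V r)) {δ : ℝ}
    (hδ : ∀ r ∈ Icc 0 s, ‖(G r - H r) * B r - B r * (G r - H r)‖ ≤ δ) :
    ‖star (U s) * a * U s - star (V s) * a * V s‖ ≤ δ := by
  have hsub : Icc 0 s ⊆ Icc (0 : ℝ) 1 := Icc_subset_Icc_right hs.2
  have hBd : ∀ r ∈ Icc (0 : ℝ) 1, HasDerivWithinAt B
      (-Complex.I • (H r * B r - B r * H r)) (Icc (0 : ℝ) 1) r := fun r hr => by
    have := hV.hasDerivWithinAt_conj_star hr (hH r hr) (star (V s) * a * V s)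
    rw [← hB r] at this
    exact this.congr (fun r _ => hB r) (hB r)
  -- The path `U(r)* B(r) U(r)` interpolates between the two evolutions of `a`, and its velocity
  -- contains only the difference of the generators.
  have h : ∀ r ∈ Icc 0 s, HasDerivWithinAt (fun r => star (U r) * B r * U r)
      (Complex.I • (star (U r) * ((G r - H r) * B r - B r * (G r - H r)) * U r)) (Icc 0 s) r :=
    fun r hr => by
      have hr' := hsub hr
      refine ((((hU.hasDerivWithinAt_star hr' (hG r hr')).mul (hBd r hr')).mul
        (hU.2 r hr')).mono hsub).congr_deriv ?_
      simp only [Pi.mul_apply, mul_sub, sub_mul, add_mul, mul_assoc, smul_mul_assoc, mul_smul_comm]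
      module
  have := (convex_Icc 0 s).norm_image_sub_le_of_norm_hasDerivWithin_le (C := δ) h
    (fun r hr => by
      rw [norm_smul, Complex.norm_I, one_mul, hU.norm_conj hG (hsub hr)]
      exact hδ r hr) (left_mem_Icc.2 hs.1) (right_mem_Icc.2 hs.1)
  have e1 : B 0 = star (V s) * a * V s := by simp [hB, hV.1]
  have e2 : B s = a := by
    rw [hB, mul_assoc, mul_assoc, mul_assoc, hV.mul_star_self hH hs, mul_one, ← mul_assoc,
      hV.mul_star_self hH hs, one_mul]
  rw [hU.1, e1, e2, star_one, one_mul, mul_one, sub_zero, Real.norm_of_nonneg hs.1] at this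
  refine this.trans ?_
  have hδ0 : 0 ≤ δ := (norm_nonneg _).trans (hδ 0 (left_mem_Icc.2 hs.1))
  nlinarith [hs.2]

/-- Differential form of the splitting of a transported charge: it suffices to compare the
Heisenberg evolutions of the currents. -/
theorem EvolvesBy.norm_transport_sub_le {G₁ G₂ U₁ U₂ : ℝ → A}
    (hU : EvolvesBy G U) (hU₁ : EvolvesBy G₁ U₁) (hU₂ : EvolvesBy G₂ U₂)
    (hG : ∀ s ∈ Icc (0 : ℝ) 1, IsSelfAdjoint (G s))
    (hG₁ : ∀ s ∈ Icc (0 : ℝ) 1, IsSelfAdjoint (G₁ s))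
    (hG₂ : ∀ s ∈ Icc (0 : ℝ) 1, IsSelfAdjoint (G₂ s)) {q : A} {δ : ℝ}
    (hsplit : ∀ s ∈ Icc (0 : ℝ) 1,
      G s * q - q * G s = (G₁ s * q - q * G₁ s) + (G₂ s * q - q * G₂ s))
    (h₁ : ∀ s ∈ Icc (0 : ℝ) 1, ‖star (U s) * (G₁ s * q - q * G₁ s) * U s
      - star (U₁ s) * (G₁ s * q - q * G₁ s) * U₁ s‖ ≤ δ)
    (h₂ : ∀ s ∈ Icc (0 : ℝ) 1, ‖star (U s) * (G₂ s * q - q * G₂ s) * U s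
      - star (U₂ s) * (G₂ s * q - q * G₂ s) * U₂ s‖ ≤ δ) :
    ‖(star (U 1) * q * U 1 - q) - ((star (U₁ 1) * q * U₁ 1 - q) +
      (star (U₂ 1) * q * U₂ 1 - q))‖ ≤ 2 * δ := by
  have h : ∀ s ∈ Icc (0 : ℝ) 1, HasDerivWithinAt
      (fun s => (star (U s) * q * U s - q) - ((star (U₁ s) * q * U₁ s - q) +
        (star (U₂ s) * q * U₂ s - q)))
      (Complex.I • ((star (U s) * (G₁ s * q - q * G₁ s) * U s
          - star (U₁ s) * (G₁ s * q - q * G₁ s) * U₁ s)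
        + (star (U s) * (G₂ s * q - q * G₂ s) * U s
          - star (U₂ s) * (G₂ s * q - q * G₂ s) * U₂ s))) (Icc 0 1) s := fun s hs => by
    refine (((hU.hasDerivWithinAt_conj hs (hG s hs) q).sub_const q).sub
      (((hU₁.hasDerivWithinAt_conj hs (hG₁ s hs) q).sub_const q).add
      ((hU₂.hasDerivWithinAt_conj hs (hG₂ s hs) q).sub_const q))).congr_deriv ?_
    rw [hsplit s hs, mul_add, add_mul]
    module
  have := (convex_Icc (0 : ℝ) 1).norm_image_sub_le_of_norm_hasDerivWithin_le (C := 2 * δ) h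
    (fun s hs => by
      rw [norm_smul, Complex.norm_I, one_mul, two_mul]
      exact (norm_add_le _ _).trans (add_le_add (h₁ s hs) (h₂ s hs)))
    (left_mem_Icc.2 zero_le_one) (right_mem_Icc.2 zero_le_one)
  simpa [hU.1, hU₁.1, hU₂.1] using this

end Generic

/-! ### The Lieb-Robinson bound. -/

section LiebRobinson

variable {sp : Species} {n d L : ℕ} [NeZero L]

/-- Union bound: each `Y` is charged to a site that it shares with `X`. -/
lemma sum_not_disjoint_le {f : Finset (Torus d L) → ℝ} (hf : ∀ X, 0 ≤ f X) {J : ℝ}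
    (hJ : ∀ x, ∑ Y with x ∈ Y, f Y ≤ J) (F : Finset (Finset (Torus d L)))
    (X : Finset (Torus d L)) (hF : ∀ Y ∈ F, ¬ Disjoint Y X) : ∑ Y ∈ F, f Y ≤ X.card * J := by
  classical
  calc ∑ Y ∈ F, f Y ≤ ∑ Y ∈ F, ∑ x ∈ X, if x ∈ Y then f Y else 0 := by
        refine Finset.sum_le_sum fun Y hY => ?_
        obtain ⟨x, hxY, hxX⟩ := Finset.not_disjoint_iff.1 (hF Y hY)
        refine (if_pos hxY).symm.trans_le (Finset.single_le_sum
          (f := fun x => if x ∈ Y then f Y else 0) (fun x _ => ?_) hxX)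
        split_ifs
        exacts [hf Y, le_rfl]
    _ = ∑ x ∈ X, ∑ Y ∈ F, if x ∈ Y then f Y else 0 := Finset.sum_comm
    _ ≤ ∑ x ∈ X, ∑ Y with x ∈ Y, f Y := by
        refine Finset.sum_le_sum fun x _ => ?_
        rw [Finset.sum_filter]
        refine Finset.sum_le_sum_of_subset_of_nonneg (Finset.subset_univ _) fun Y _ _ => ?_
        split_ifs
        exacts [hf Y, le_rfl]
    _ ≤ ∑ x ∈ X, J := Finset.sum_le_sum fun x _ => hJ x
    _ = _ := by rw [Finset.sum_const, nsmul_eq_mul]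

/-- **Lieb-Robinson bound** for finite-range interactions, in the form of a factorially decaying
bound with as many orders as steps of the range are needed to connect the two supports. -/
theorem lieb_robinson {Ψ : Finset (Torus d L) → ℝ → Op sp n d L} {T J : ℝ} {R : ℕ} (hJ0 : 0 ≤ J)
    (mem : ∀ X, ∀ t ∈ Icc 0 T, Ψ X t ∈ localAlg sp X)
    (sa : ∀ X, ∀ t ∈ Icc 0 T, IsSelfAdjoint (Ψ X t))
    (range : ∀ X, R < diam X → ∀ t ∈ Icc 0 T, Ψ X t = 0)
    (perSite : ∀ t ∈ Icc 0 T, ∀ x, ∑ X with x ∈ X, ‖Ψ X t‖ ≤ J)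
    (F : Finset (Finset (Torus d L))) {B : ℝ → Op sp n d L}
    (hB : ∀ t ∈ Icc 0 T, HasDerivWithinAt B
      (Complex.I • ((∑ X ∈ F, Ψ X t) * B t - B t * ∑ X ∈ F, Ψ X t)) (Icc 0 T) t)
    {S : Finset (Torus d L)} (hS : B 0 ∈ localAlg sp S) (k : ℕ) :
    ∀ (X : Finset (Torus d L)) (C : Op sp n d L), C ∈ localAlg sp X → diam X ≤ R →
      (∀ x ∈ X, ∀ y ∈ S, k * (R + 1) ≤ tdist x y) → ∀ t ∈ Icc 0 T,
      ‖C * B t - B t * C‖ ≤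
        2 * ‖C‖ * ‖B 0‖ * ((2 * (2 * R + 1) ^ d * J * t) ^ k / k.factorial) := by
  classical
  -- A set of diameter at most `R` has at most `(2R + 1) ^ d` sites, each met by terms of total norm
  -- `J`; the 2 comes from expanding a commutator.
  set κ : ℝ := 2 * (2 * R + 1) ^ d * J with hκ
  have hκ0 : 0 ≤ κ := by positivity
  induction k with
  | zero =>
    intro X C _ _ _ t ht
    have hBt : ‖B t‖ ≤ ‖B 0‖ := by
      refine norm_le_of_deriv_commutator_add (A := Op sp n d L) (D := B)
        (K := fun t => ∑ X ∈ F, Ψ X t) (E := fun _ => 0) (b := fun _ => ‖B 0‖) (b' := fun _ => 0)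
        (fun t ht => isSelfAdjoint_sum (R := Op sp n d L) _ fun X _ => sa X t ht)
        (fun t ht => (hB t ht).congr_deriv (add_zero _).symm) le_rfl
        (fun t => hasDerivAt_const _ _) (fun t _ => norm_zero.le) t ht
    refine (norm_commutator_le C (B t)).trans ?_
    simp only [pow_zero, Nat.factorial_zero, Nat.cast_one, div_one, mul_one]
    gcongr
  | succ k ih =>
    intro X C hC hX hdist
    refine norm_commutator_le_of_deriv (A := Op sp n d L) (B := B) (C := C)
      (K := fun t => ∑ Y ∈ F with Disjoint Y X, Ψ Y t)
      (N := fun t => ∑ Y ∈ F with ¬ Disjoint Y X, Ψ Y t)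
      (b := fun t => 2 * ‖C‖ * ‖B 0‖ * ((κ * t) ^ (k + 1) / (k + 1).factorial))
      (b' := fun t => 2 * ‖C‖ * ‖B 0‖ * (κ * ((κ * t) ^ k / k.factorial)))
      (fun t ht => isSelfAdjoint_sum (R := Op sp n d L) _ fun Y _ => sa Y t ht)
      (fun t ht => Commute.sum_right _ _ _ fun Y hY =>
        localAlg_commute (Finset.mem_filter.1 hY).2.symm hC (mem Y t ht))
      (fun t ht => (hB t ht).congr_deriv ?_) ?_ ?_ ?_
    · rw [Finset.sum_filter_add_sum_filter_not]
    -- The gap `(k + 1)(R + 1)` is positive, so the commutator vanishes at time zero.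
    · have hdisj : Disjoint X S := Finset.disjoint_left.2 fun x hx hxS => by
        have := hdist x hx x hxS
        rw [tdist_self] at this
        exact absurd this (Nat.not_le.2 (by positivity))
      rw [(localAlg_commute hdisj hC hS).eq, sub_self, norm_zero]
      positivity
    · intro t
      have h1 : HasDerivAt (fun t : ℝ => κ * t) κ t := by
        simpa using (hasDerivAt_id t).const_mul κ
      refine (((h1.pow (k + 1)).div_const _).const_mul _).congr_deriv ?_
      rw [Nat.factorial_succ]
      push_cast
      field_simp
    · intro t ht
      have hk0 : 0 ≤ (κ * t) ^ k / k.factorial := by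
        have := ht.1
        positivity
      -- A term meeting `X` comes closer to `S` by at most its diameter `R`, so a gap of `k (R + 1)`
      -- is left for the induction hypothesis. Integrating its bound in time produces the next
      -- factorial order.
      have hstep : ∀ Y ∈ F.filter (fun Y => ¬ Disjoint Y X), ‖Ψ Y t * B t - B t * Ψ Y t‖ ≤
          ‖Ψ Y t‖ * (2 * ‖B 0‖ * ((κ * t) ^ k / k.factorial)) := by
        intro Y hY
        by_cases hYR : diam Y ≤ R
        · refine (ih Y _ (mem Y t ht) hYR (fun w hw y hy => ?_) t ht).trans_eq (by ring)
          obtain ⟨z, hzY, hzX⟩ := Finset.not_disjoint_iff.1 (Finset.mem_filter.1 hY).2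
          have h1 := hdist z hzX y hy
          have h2 := tdist_triangle z w y
          have h3 := (tdist_le_diam hzY hw).trans hYR
          rw [add_mul] at h1
          omega
        · rw [range Y (not_le.1 hYR) t ht]
          simp
      have hsum : ∑ Y ∈ F.filter (fun Y => ¬ Disjoint Y X), ‖Ψ Y t‖ ≤ (2 * R + 1) ^ d * J := by
        refine (sum_not_disjoint_le (fun _ => norm_nonneg _) (perSite t ht) _ X
          fun Y hY => (Finset.mem_filter.1 hY).2).trans ?_
        gcongr
        exact_mod_cast card_le_of_diam_le hX
      calc _ ≤ 2 * ‖C‖ * (∑ Y ∈ F with ¬ Disjoint Y X, ‖Ψ Y t * B t - B t * Ψ Y t‖) := by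
            gcongr
            exact norm_sum_commutator_le (A := Op sp n d L) _ _ _
        _ ≤ 2 * ‖C‖ * (∑ Y ∈ F with ¬ Disjoint Y X,
              ‖Ψ Y t‖ * (2 * ‖B 0‖ * ((κ * t) ^ k / k.factorial))) := by
            gcongr with Y hY
            exact hstep Y hY
        _ ≤ 2 * ‖C‖ * (((2 * R + 1) ^ d * J) * (2 * ‖B 0‖ * ((κ * t) ^ k / k.factorial))) := by
            rw [← Finset.sum_mul]
            gcongr
        _ = _ := by rw [hκ]; ring

end LiebRobinson

end

section

open Set

/-! ### Splitting the transported charge at finite range. -/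

section FiniteVolume

variable {sp : Species} {n d L : ℕ} [NeZero L]

lemma IsPropagator.evolvesBy {G U : ℝ → Op sp n d L} (h : IsPropagator G U) : EvolvesBy G U := h

/-- A charge-conserving interaction of range `R` whose terms containing a given site have total
norm at most `J`. -/
structure IsShortRange (Q : Torus d L → Op sp n d L) (Ψ : Finset (Torus d L) → ℝ → Op sp n d L)
    (R : ℕ) (J : ℝ) : Prop where
  mem : ∀ X, ∀ s ∈ Icc (0 : ℝ) 1, Ψ X s ∈ localAlg sp X
  selfAdjoint : ∀ X, ∀ s ∈ Icc (0 : ℝ) 1, IsSelfAdjoint (Ψ X s)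
  continuousOn : ∀ X, ContinuousOn (Ψ X) (Icc (0 : ℝ) 1)
  conserve : ∀ X Y, X ⊆ Y → ∀ s ∈ Icc (0 : ℝ) 1, Commute (Ψ X s) (charge Q Y)
  range : ∀ X, R < diam X → ∀ s ∈ Icc (0 : ℝ) 1, Ψ X s = 0
  perSite : ∀ s ∈ Icc (0 : ℝ) 1, ∀ x, ∑ X with x ∈ X, ‖Ψ X s‖ ≤ J

variable {Q : Torus d L → Op sp n d L} {Ψ : Finset (Torus d L) → ℝ → Op sp n d L} {R : ℕ} {J : ℝ}

lemma isSelfAdjoint_generatorIn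
    (h : ∀ X, ∀ s ∈ Icc (0 : ℝ) 1, IsSelfAdjoint (Ψ X s)) (Z : Finset (Torus d L)) :
    ∀ s ∈ Icc (0 : ℝ) 1, IsSelfAdjoint (generatorIn Z Ψ s) := fun s hs =>
  isSelfAdjoint_sum (R := Op sp n d L) _ fun X _ => h X s hs

lemma continuousOn_generatorIn
    (h : ∀ X, ContinuousOn (Ψ X) (Icc (0 : ℝ) 1)) (Z : Finset (Torus d L)) :
    ContinuousOn (generatorIn Z Ψ) (Icc (0 : ℝ) 1) :=
  continuousOn_finsetSum _ fun X _ => h X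

lemma generator_eq_generatorIn (Ψ : Finset (Torus d L) → ℝ → Op sp n d L) :
    generator Ψ = generatorIn Finset.univ Ψ := by
  funext s
  simp [generator, generatorIn]

/-- The empty set contains no site, so the per-site bound does not control its term; it has to be
excluded. -/
lemma sum_norm_nonempty_le {f : Finset (Torus d L) → ℝ} (hf : ∀ X, 0 ≤ f X)
    (hJ : ∀ x, ∑ Y with x ∈ Y, f Y ≤ J) (F : Finset (Finset (Torus d L)))
    (hF : ∀ Y ∈ F, Y.Nonempty) : ∑ Y ∈ F, f Y ≤ (L : ℝ) ^ d * J := by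
  refine (sum_not_disjoint_le hf hJ F Finset.univ fun Y hY => ?_).trans_eq ?_
  · obtain ⟨x, hx⟩ := hF Y hY
    exact Finset.not_disjoint_iff.2 ⟨x, hx, Finset.mem_univ x⟩
  · rw [Finset.card_univ, card_torus]
    push_cast
    rfl

lemma IsShortRange.nonneg (h : IsShortRange Q Ψ R J) : 0 ≤ J :=
  (Finset.sum_nonneg fun _ _ => norm_nonneg _).trans
    (h.perSite 0 (left_mem_Icc.2 zero_le_one) fun _ => 0)

/-- Terms of the generator that are far from an observable do not affect its evolution much. -/
theorem IsShortRange.norm_conj_sub_conj_le (h : IsShortRange Q Ψ R J) {Z S : Finset (Torus d L)}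
    {k : ℕ} (hdist : ∀ Y, ¬ Y ⊆ Z → diam Y ≤ R → ∀ w ∈ Y, ∀ y ∈ S, k * (R + 1) ≤ tdist w y)
    {U V : ℝ → Op sp n d L} (hU : IsPropagator (generator Ψ) U)
    (hV : IsPropagator (generatorIn Z Ψ) V) {s : ℝ} (hs : s ∈ Icc (0 : ℝ) 1) {A : Op sp n d L}
    (hA : A ∈ localAlg sp S) :
    ‖star (U s) * A * U s - star (V s) * A * V s‖ ≤
      2 * ‖A‖ * ((2 * (2 * R + 1) ^ d * J) ^ k / k.factorial) * ((L : ℝ) ^ d * J) := by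
  classical
  have hJ := h.nonneg
  have hG : ∀ s ∈ Icc (0 : ℝ) 1, IsSelfAdjoint (generator Ψ s) := by
    rw [generator_eq_generatorIn]
    exact isSelfAdjoint_generatorIn h.selfAdjoint _
  have hH := isSelfAdjoint_generatorIn h.selfAdjoint Z
  set B : ℝ → Op sp n d L := fun r => V r * (star (V s) * A * V s) * star (V r) with hB
  have hsr : ∀ t ∈ Icc 0 s, s - t ∈ Icc (0 : ℝ) 1 := fun t ht =>
    ⟨by linarith [ht.2], by linarith [ht.1, hs.2]⟩
  have hBs : B s = A := by
    have e : V s * star (V s) = 1 := hV.evolvesBy.mul_star_self hH hs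
    calc B s = (V s * star (V s)) * A * (V s * star (V s)) := by simp only [hB, mul_assoc]
      _ = A := by rw [e, one_mul, mul_one]
  -- Locality is used for the restricted dynamics `V`; the full one enters only through conjugation
  -- by the unitary `U`.
  have hlr := lieb_robinson (Ψ := fun X t => Ψ X (s - t)) (T := s) (R := R) (S := S) hJ
    (fun X t ht => h.mem X _ (hsr t ht)) (fun X t ht => h.selfAdjoint X _ (hsr t ht))
    (fun X hX t ht => h.range X hX _ (hsr t ht)) (fun t ht x => h.perSite _ (hsr t ht) x)
    Z.powerset (B := fun t => B (s - t))
    (hV.evolvesBy.hasDerivWithinAt_reversed hH hs (star (V s) * A * V s))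
    (by simpa only [sub_zero, hBs] using hA) k
  simp only [sub_zero, hBs] at hlr
  refine hU.evolvesBy.norm_conj_sub_conj_le hV.evolvesBy hG hH hs (B := B) (fun _ => rfl) ?_
  intro r hr
  have hr1 : r ∈ Icc (0 : ℝ) 1 := ⟨hr.1, hr.2.trans hs.2⟩
  set E : ℝ := 2 * ‖A‖ * ((2 * (2 * R + 1) ^ d * J) ^ k / k.factorial) with hE
  have hE0 : 0 ≤ E := by positivity
  have hdiff : generator Ψ r - generatorIn Z Ψ r = ∑ Y with ¬ Y ⊆ Z, Ψ Y r := by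
    rw [generator, generatorIn, sub_eq_iff_eq_add,
      ← Finset.sum_filter_not_add_sum_filter _ (fun Y => Y ⊆ Z)]
    congr 2
    ext Y
    simp
  rw [hdiff]
  calc _ ≤ ∑ Y with ¬ Y ⊆ Z, ‖Ψ Y r * B r - B r * Ψ Y r‖ :=
        norm_sum_commutator_le (A := Op sp n d L) _ _ _
    _ ≤ ∑ Y with ¬ Y ⊆ Z, E * ‖Ψ Y r‖ := by
        refine Finset.sum_le_sum fun Y hY => ?_
        have hYZ := (Finset.mem_filter.1 hY).2
        by_cases hYR : diam Y ≤ R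
        · have h1 := hlr Y (Ψ Y r) (h.mem Y r hr1) hYR (hdist Y hYZ hYR) (s - r)
            ⟨by linarith [hr.2], by linarith [hr.1]⟩
          rw [sub_sub_cancel] at h1
          refine h1.trans ?_
          have h2 : (2 * (2 * (R : ℝ) + 1) ^ d * J * (s - r)) ^ k ≤
              (2 * (2 * (R : ℝ) + 1) ^ d * J) ^ k := by
            have h3 : 0 ≤ s - r := by linarith [hr.2]
            have h4 : s - r ≤ 1 := by linarith [hr.1, hs.2]
            refine pow_le_pow_left₀ (by positivity) ?_ k
            exact mul_le_of_le_one_right (by positivity) h4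
          calc _ ≤ 2 * ‖Ψ Y r‖ * ‖A‖ * ((2 * (2 * R + 1) ^ d * J) ^ k / k.factorial) := by gcongr
            _ = _ := by rw [hE]; ring
        · rw [h.range Y (not_le.1 hYR) r hr1]
          simp
    _ = E * ∑ Y with ¬ Y ⊆ Z, ‖Ψ Y r‖ := (Finset.mul_sum _ _ _).symm
    _ ≤ _ := by
        refine mul_le_mul_of_nonneg_left (sum_norm_nonempty_le (fun _ => norm_nonneg _)
          (h.perSite r hr1) _ fun Y hY => ?_) hE0
        rw [Finset.nonempty_iff_ne_empty]
        rintro rfl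
        exact (Finset.mem_filter.1 hY).2 (Finset.empty_subset _)

/-- The current through the boundary of `Γ` carried by the set `X`. -/
noncomputable def current (Q : Torus d L → Op sp n d L) (Γ : Finset (Torus d L))
    (Ψ : Finset (Torus d L) → ℝ → Op sp n d L) (X : Finset (Torus d L)) (s : ℝ) : Op sp n d L :=
  Ψ X s * charge Q Γ - charge Q Γ * Ψ X s

lemma charge_eq_inter_add_sdiff (Q : Torus d L → Op sp n d L) (Γ X : Finset (Torus d L)) :
    charge Q Γ = charge Q (Γ ∩ X) + charge Q (Γ \ X) :=
  (Finset.sum_inter_add_sum_sdiff _ _ _).symm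

/-- A set that does not straddle either misses Γ, where locality applies, or lies inside Γ, where
conservation applies. -/
lemma IsShortRange.current_eq_zero (h : IsShortRange Q Ψ R J) (hQ : IsLocalCharge Q)
    {Γ X : Finset (Torus d L)} {s : ℝ} (hs : s ∈ Icc (0 : ℝ) 1)
    (hX : ¬ ((∃ x ∈ X, x ∈ Γ) ∧ ∃ y ∈ X, y ∉ Γ)) : current Q Γ Ψ X s = 0 := by
  rw [current, sub_eq_zero]
  by_cases h1 : ∃ y ∈ X, y ∉ Γ
  · have h2 : Disjoint X Γ := Finset.disjoint_left.2 fun x hx hxΓ => hX ⟨⟨x, hx, hxΓ⟩, h1⟩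
    exact localAlg_commute h2 (h.mem X s hs)
      (mem_localSubalgebra.1 (charge_mem_localSubalgebra hQ Γ))
  · push Not at h1
    exact h.conserve X Γ h1 s hs

/-- The charge outside `X` commutes with `Ψ X s`, so only the charge of `Γ ∩ X` enters. -/
lemma IsShortRange.current_mem (h : IsShortRange Q Ψ R J) (hQ : IsLocalCharge Q)
    {Γ X : Finset (Torus d L)} {s : ℝ} (hs : s ∈ Icc (0 : ℝ) 1) :
    current Q Γ Ψ X s ∈ localAlg sp X := by
  have h1 : Commute (Ψ X s) (charge Q (Γ \ X)) :=
    localAlg_commute Finset.disjoint_sdiff (h.mem X s hs)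
      (mem_localSubalgebra.1 (charge_mem_localSubalgebra hQ _))
  have h2 : current Q Γ Ψ X s = Ψ X s * charge Q (Γ ∩ X) - charge Q (Γ ∩ X) * Ψ X s := by
    rw [current, charge_eq_inter_add_sdiff Q Γ X, mul_add, add_mul, h1.eq]
    abel
  have h3 : charge Q (Γ ∩ X) ∈ localSubalgebra sp n X :=
    mem_localSubalgebra.2 (localAlg_mono Finset.inter_subset_right
      (mem_localSubalgebra.1 (charge_mem_localSubalgebra hQ _)))
  have h4 : Ψ X s ∈ localSubalgebra sp n X := mem_localSubalgebra.2 (h.mem X s hs)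
  rw [h2]
  exact mem_localSubalgebra.1 (Subalgebra.sub_mem _ (Subalgebra.mul_mem _ h4 h3)
    (Subalgebra.mul_mem _ h3 h4))

lemma norm_conj_sum_sub_le {A : Type*} [CStarAlgebra A] {ι : Type*} (s : Finset ι) (f : ι → A)
    (u v : A) {g : ι → ℝ} (h : ∀ i ∈ s, ‖star u * f i * u - star v * f i * v‖ ≤ g i) :
    ‖star u * (∑ i ∈ s, f i) * u - star v * (∑ i ∈ s, f i) * v‖ ≤ ∑ i ∈ s, g i := by
  simp only [Finset.mul_sum, Finset.sum_mul, ← Finset.sum_sub_distrib]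
  exact norm_sum_le_of_le _ h

variable [NeZero d]

/-- The straddling sets are far from the sets that leave the fattened boundary. -/
lemma le_tdist_of_not_subset_fatten {c : ZMod L} {r k : ℕ} (hr : k * (R + 1) + 3 * R ≤ r)
    {X Y : Finset (Torus d L)}
    (hX : X ⊆ fatten (Finset.univ.filter fun x : Torus d L => x 0 = c) (2 * R))
    (hY : ¬ Y ⊆ fatten (Finset.univ.filter fun x : Torus d L => x 0 = c) r) (hYR : diam Y ≤ R) :
    ∀ w ∈ Y, ∀ y ∈ X, k * (R + 1) ≤ tdist w y := by
  intro w hw y hy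
  obtain ⟨z, hz, hzZ⟩ := Finset.not_subset.1 hY
  rw [mem_fatten_hyperplane] at hzZ
  -- The loss `3R` consists of `2R` for the width of the strip containing `X` and `R` for the
  -- diameter of `Y`.
  have h1 := mem_fatten_hyperplane.1 (hX hy)
  have h2 := circ_sub_le (z 0) (w 0) c
  have h3 := circ_sub_le (w 0) (y 0) c
  have h4 := (circ_le_tdist z w 0).trans ((tdist_le_diam hz hw).trans hYR)
  have h5 := circ_le_tdist w y 0
  omega

/-- The transported charge of a finite-range evolution splits into two boundary contributions. -/
theorem IsShortRange.norm_transported_sub_le (h : IsShortRange Q Ψ R J) (hQ : IsLocalCharge Q)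
    (heven : Even L) {k : ℕ} (hk : k * (R + 1) + 3 * R + 1 ≤ L / 12)
    {U Uplus Uminus : ℝ → Op sp n d L} (hU : IsPropagator (generator Ψ) U)
    (hUplus : IsPropagator (generatorIn (fatten (bdryPlus d L) (L / 12)) Ψ) Uplus)
    (hUminus : IsPropagator (generatorIn (fatten (bdryMinus d L) (L / 12)) Ψ) Uminus) :
    ‖transported Q (U 1) - (transported Q (Uplus 1) + transported Q (Uminus 1))‖ ≤
      8 * ‖charge Q (halfTorus d L)‖ * ((L : ℝ) ^ d * J) ^ 2 *
        ((2 * (2 * R + 1) ^ d * J) ^ k / k.factorial) := by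
  classical
  have hJ := h.nonneg
  set Γ := halfTorus d L with hΓ
  have hG : ∀ s ∈ Icc (0 : ℝ) 1, IsSelfAdjoint (generator Ψ s) := by
    rw [generator_eq_generatorIn]
    exact isSelfAdjoint_generatorIn h.selfAdjoint _
  have hcur : ∀ F : Finset (Finset (Torus d L)), ∀ s,
      (∑ X ∈ F, Ψ X s) * charge Q Γ - charge Q Γ * (∑ X ∈ F, Ψ X s) =
        ∑ X ∈ F, current Q Γ Ψ X s := fun F s => by
    rw [Finset.sum_mul, Finset.mul_sum, ← Finset.sum_sub_distrib]
    rfl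
  have hstr : ∀ s ∈ Icc (0 : ℝ) 1, ∀ X, current Q Γ Ψ X s ≠ 0 → X.Nonempty ∧
      (X ⊆ fatten (bdryMinus d L) (2 * R) ∨ X ⊆ fatten (bdryPlus d L) (2 * R)) := by
    intro s hs X hX
    have hXR : diam X ≤ R := by
      by_contra hXR
      exact hX (by rw [current, h.range X (not_le.1 hXR) s hs, zero_mul, mul_zero, sub_zero])
    obtain ⟨⟨x, hx, hxΓ⟩, y, hy, hyΓ⟩ := not_not.1 (mt (h.current_eq_zero hQ hs) hX)
    exact ⟨⟨x, hx⟩, subset_fatten_of_straddle hXR heven hx hy hxΓ hyΓ⟩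
  have hmono : ∀ {P : Finset (Torus d L)}, fatten P (2 * R) ⊆ fatten P (L / 12) := by
    intro P x hx
    simp only [fatten, Finset.mem_filter, Finset.mem_univ, true_and] at hx ⊢
    obtain ⟨y, hy, hxy⟩ := hx
    exact ⟨y, hy, by omega⟩
  -- `hk` forces `1 ≤ L / 12`, which is enough for the two strips to be disjoint.
  have hboth : ∀ {X : Finset (Torus d L)}, X.Nonempty → X ⊆ fatten (bdryMinus d L) (L / 12) →
      X ⊆ fatten (bdryPlus d L) (L / 12) → False := fun ⟨x, hx⟩ h1 h2 =>
    not_mem_fatten_both (by omega) (h1 hx) (h2 hx)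
  -- Stated for an arbitrary hyperplane so as to serve both boundaries. The 4 combines the 2 of the
  -- evolution bound with the 2 of `‖[Ψ, Q]‖`; one volume factor sums the omitted terms, the other
  -- the currents.
  have hpart : ∀ {c : ZMod L} {V : ℝ → Op sp n d L},
      (IsPropagator (generatorIn (fatten (Finset.univ.filter fun x : Torus d L => x 0 = c)
        (L / 12)) Ψ) V) →
      (∀ s ∈ Icc (0 : ℝ) 1, ∀ X, current Q Γ Ψ X s ≠ 0 →
        X ⊆ fatten (Finset.univ.filter fun x : Torus d L => x 0 = c) (L / 12) →
        X ⊆ fatten (Finset.univ.filter fun x : Torus d L => x 0 = c) (2 * R)) →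
      ∀ s ∈ Icc (0 : ℝ) 1,
        ‖star (U s) * (∑ X ∈ (fatten (Finset.univ.filter fun x : Torus d L => x 0 = c)
            (L / 12)).powerset, current Q Γ Ψ X s) * U s
          - star (V s) * (∑ X ∈ (fatten (Finset.univ.filter fun x : Torus d L => x 0 = c)
            (L / 12)).powerset, current Q Γ Ψ X s) * V s‖ ≤
        4 * ‖charge Q Γ‖ * ((L : ℝ) ^ d * J) ^ 2 *
          ((2 * (2 * R + 1) ^ d * J) ^ k / k.factorial) := by
    intro c V hV hc s hs
    set Z := fatten (Finset.univ.filter fun x : Torus d L => x 0 = c) (L / 12) with hZ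
    set ε : ℝ := (2 * (2 * R + 1) ^ d * J) ^ k / k.factorial with hε
    have hε0 : 0 ≤ ε := by positivity
    refine (norm_conj_sum_sub_le (A := Op sp n d L) _ _ _ _
      (g := fun X => if X.Nonempty then
        4 * ‖charge Q Γ‖ * ε * ((L : ℝ) ^ d * J) * ‖Ψ X s‖ else 0) fun X hX => ?_).trans ?_
    · by_cases h0 : current Q Γ Ψ X s = 0
      · rw [h0, mul_zero, zero_mul, mul_zero, zero_mul, sub_zero, norm_zero]
        split_ifs
        exacts [by positivity, le_rfl]
      · rw [if_pos (hstr s hs X h0).1]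
        refine (h.norm_conj_sub_conj_le (S := X) (Z := Z) (k := k) (fun Y hYZ hYR =>
          le_tdist_of_not_subset_fatten (r := L / 12) (by omega)
            (hc s hs X h0 (Finset.mem_powerset.1 hX)) hYZ hYR) hU hV hs
            (h.current_mem hQ hs)).trans ?_
        have := norm_commutator_le (A := Op sp n d L) (Ψ X s) (charge Q Γ)
        calc _ ≤ 2 * (2 * ‖Ψ X s‖ * ‖charge Q Γ‖) * ε * ((L : ℝ) ^ d * J) := by
              gcongr
              exact this
          _ = _ := by ring
    · rw [← Finset.sum_filter, ← Finset.mul_sum]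
      calc _ ≤ 4 * ‖charge Q Γ‖ * ε * ((L : ℝ) ^ d * J) * ((L : ℝ) ^ d * J) := by
            gcongr
            exact sum_norm_nonempty_le (fun _ => norm_nonneg _) (h.perSite s hs) _
              fun Y hY => (Finset.mem_filter.1 hY).2
        _ = _ := by ring
  have hplus := hpart hUplus fun s hs X hX hXZ => by
    obtain ⟨hne, h1 | h1⟩ := hstr s hs X hX
    · exact (hboth hne (h1.trans hmono) hXZ).elim
    · exact h1
  have hminus := hpart hUminus fun s hs X hX hXZ => by
    obtain ⟨hne, h1 | h1⟩ := hstr s hs X hX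
    · exact h1
    · exact (hboth hne hXZ (h1.trans hmono)).elim
  refine (hU.evolvesBy.norm_transport_sub_le hUplus.evolvesBy hUminus.evolvesBy hG
    (isSelfAdjoint_generatorIn h.selfAdjoint _) (isSelfAdjoint_generatorIn h.selfAdjoint _)
    (q := charge Q Γ) (δ := 4 * ‖charge Q Γ‖ * ((L : ℝ) ^ d * J) ^ 2 *
        ((2 * (2 * R + 1) ^ d * J) ^ k / k.factorial)) ?_ ?_ ?_).trans_eq (by ring)
  -- Each nonzero current lies in exactly one of the two strips, so the two restricted sums
  -- reproduce the full one.
  · intro s hs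
    rw [generator, generatorIn, generatorIn, hcur, hcur, hcur]
    simp only [← Finset.filter_subset_univ, Finset.sum_filter]
    rw [← Finset.sum_add_distrib]
    refine Finset.sum_congr rfl fun X _ => ?_
    by_cases h0 : current Q Γ Ψ X s = 0
    · simp [h0]
    · obtain ⟨hne, h1 | h1⟩ := hstr s hs X h0
      · rw [if_neg fun h2 => hboth hne (h1.trans hmono) h2, if_pos (h1.trans hmono), zero_add]
      · rw [if_neg fun h2 => hboth hne h2 (h1.trans hmono), if_pos (h1.trans hmono), add_zero]
  · intro s hs
    rw [generatorIn, hcur]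
    exact hplus s hs
  · intro s hs
    rw [generatorIn, hcur]
    exact hminus s hs

end FiniteVolume

end

/-! ### Choice of cut-off and decay faster than any power. -/

section Asymptotics

lemma isVerySmall_of_eventually {f : ℕ → ℝ} (h : ∀ k : ℕ, ∃ (C : ℝ) (N₀ : ℕ), ∀ N, N₀ ≤ N →
    |f N| * (side N : ℝ) ^ k ≤ C) : IsVerySmall f := by
  intro k
  obtain ⟨C, N₀, hC⟩ := h k
  refine ⟨max C (∑ N ∈ Finset.range N₀, |f N| * (side N : ℝ) ^ k), fun N => ?_⟩
  have hpos : (0 : ℝ) < (side N : ℝ) ^ k := by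
    have : 0 < side N := by simp [side]
    positivity
  rw [le_div_iff₀ hpos]
  rcases le_or_gt N₀ N with hN | hN
  · exact (hC N hN).trans (le_max_left _ _)
  · exact (Finset.single_le_sum (f := fun N => |f N| * (side N : ℝ) ^ k)
      (fun N _ => by positivity) (Finset.mem_range.2 hN)).trans (le_max_right _ _)

lemma exists_pow_mul_half_pow_le (a : ℕ) : ∃ M : ℝ, ∀ R : ℕ, (R : ℝ) ^ a * (1 / 2) ^ R ≤ M := by
  obtain ⟨M, hM⟩ := (tendsto_pow_const_mul_const_pow_of_abs_lt_one a
    (r := 1 / 2) (by norm_num [abs_of_pos])).bddAbove_range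
  exact ⟨M, fun R => hM ⟨R, rfl⟩⟩

/-- With `k = R ^ (d + 1)` orders, the factorial beats the volume of a ball of radius `R`. -/
lemma pow_div_factorial_le_half_pow {d R : ℕ} {κ c : ℝ} (hκ0 : 0 ≤ κ) (hκ : κ ≤ c * (R : ℝ) ^ d)
    (hR : 1 ≤ R) (hc : 2 * (Real.exp 1 * c) ≤ R) :
    κ ^ (R ^ (d + 1)) / (R ^ (d + 1)).factorial ≤ (1 / 2 : ℝ) ^ R := by
  set k : ℕ := R ^ (d + 1) with hk
  have hk0 : (0 : ℝ) < k := by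
    have : 0 < k := by positivity
    exact_mod_cast this
  have hR0 : (0 : ℝ) < R := by exact_mod_cast hR
  have h1 := Real.pow_div_factorial_le_exp (k : ℝ) hk0.le k
  have h2 : Real.exp k = Real.exp 1 ^ k := by rw [← Real.exp_nat_mul, mul_one]
  -- As `k! ≥ (k / e) ^ k`, it is enough to bound `e κ / k` by `e c / R`.
  have h3 : Real.exp 1 * κ / k ≤ 1 / 2 := by
    rw [div_le_iff₀ hk0]
    have e : (k : ℝ) = R ^ d * R := by rw [hk]; push_cast; ring
    rw [e]
    calc Real.exp 1 * κ ≤ Real.exp 1 * (c * R ^ d) := by gcongr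
      _ = 1 / 2 * (R ^ d * (2 * (Real.exp 1 * c))) := by ring
      _ ≤ 1 / 2 * (R ^ d * R) := by gcongr
  calc κ ^ k / k.factorial = (κ / k) ^ k * ((k : ℝ) ^ k / k.factorial) := by
        rw [div_pow]; field_simp
    _ ≤ (κ / k) ^ k * Real.exp 1 ^ k := by rw [← h2]; gcongr
    _ = (Real.exp 1 * κ / k) ^ k := by rw [← mul_pow]; ring
    _ ≤ (1 / 2) ^ k := by gcongr
    _ ≤ (1 / 2) ^ R := pow_le_pow_of_le_one (by norm_num) (by norm_num)
        (Nat.le_self_pow (by omega) R)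

/-- A quantity bounded by a rapidly decaying tail beyond a cut-off `R` and by a Lieb-Robinson term
with cut-off `R`, for every admissible `R`, is very small. -/
theorem isVerySmall_of_le_tail_add_lieb_robinson {f : ℕ → ℝ} (hf0 : ∀ N, 0 ≤ f N) {a b d : ℕ}
    {J c : ℝ} (hJ : 0 ≤ J) (hc : 0 ≤ c)
    (hf : ∀ j : ℕ, ∃ D : ℝ, 0 ≤ D ∧ ∀ N R k : ℕ, 1 ≤ R → k * (R + 1) + 3 * R + 1 ≤ side N / 12 →
      f N ≤ D * ((side N : ℝ) ^ a / (R : ℝ) ^ j) +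
        c * (side N : ℝ) ^ b * ((2 * (2 * (R : ℝ) + 1) ^ d * J) ^ k / k.factorial)) :
    IsVerySmall f := by
  refine isVerySmall_of_eventually fun K => ?_
  -- `k (R + 1)` has order `R ^ (d + 2)` and must fit into `L / 12`; one further power of `R`
  -- absorbs the constants. The tail exponent `p * (a + K)` below matches `L ^ (a + K)`, since `L <
  -- (R + 1) ^ p`.
  set p : ℕ := d + 3 with hp
  obtain ⟨D, hD, hfD⟩ := hf (p * (a + K))
  obtain ⟨M, hM⟩ := exists_pow_mul_half_pow_le (p * (b + K))
  obtain ⟨R₁, hR₁⟩ := exists_nat_ge (2 * (Real.exp 1 * (2 * 3 ^ d * J)))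
  -- 72 is 12 times 6, where `R ^ (d+2) + R ^ (d+1) + 3R + 1 ≤ 6 R ^ (d+2)`; `R₁` makes the
  -- factorial estimate applicable.
  set R₀ : ℕ := max 72 R₁ with hR₀
  refine ⟨D * 2 ^ (p * (a + K)) + c * 2 ^ (p * (b + K)) * M, R₀ ^ p, fun N hN => ?_⟩
  set L : ℕ := side N with hL
  have hNL : R₀ ^ p ≤ L := hN.trans (by rw [hL, side]; omega)
  set R : ℕ := Nat.nthRoot p L with hR
  have hRR : R₀ ≤ R := (Nat.le_nthRoot_iff (by omega)).2 hNL
  have hR72 : 72 ≤ R := (le_max_left _ _).trans hRR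
  have hRR₁ : R₁ ≤ R := (le_max_right _ _).trans hRR
  have hle : R ^ p ≤ L := Nat.pow_nthRoot_le (.inl (by omega))
  have hlt : L < (R + 1) ^ p := Nat.lt_pow_nthRoot_add_one (by omega) L
  have hL2 : (L : ℝ) ≤ (2 * R) ^ p := by
    have : L ≤ (2 * R) ^ p := hlt.le.trans (Nat.pow_le_pow_left (by omega) p)
    exact_mod_cast this
  have hR0 : (0 : ℝ) < R := by
    have : 0 < R := by omega
    exact_mod_cast this
  have hk : R ^ (d + 1) * (R + 1) + 3 * R + 1 ≤ L / 12 := by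
    rw [Nat.le_div_iff_mul_le (by norm_num)]
    have h1 : R ^ p = R ^ (d + 1) * R * R := by rw [hp]; ring
    have h2 : R ≤ R ^ (d + 1) * R := Nat.le_mul_of_pos_left _ (by positivity)
    have h3 : R ^ (d + 1) ≤ R ^ (d + 1) * R := Nat.le_mul_of_pos_right _ (by omega)
    have h4 : R ^ (d + 1) * R * 72 ≤ R ^ (d + 1) * R * R := Nat.mul_le_mul_left _ hR72
    rw [mul_add, mul_one]
    omega
  have hmain := hfD N R (R ^ (d + 1)) (by omega) hk
  have hfac := pow_div_factorial_le_half_pow (d := d) (R := R)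
    (κ := 2 * (2 * (R : ℝ) + 1) ^ d * J) (c := 2 * 3 ^ d * J) (by positivity) (by
      have : (2 * (R : ℝ) + 1) ^ d ≤ (3 * R) ^ d := by
        have : (1 : ℝ) ≤ R := by exact_mod_cast (by omega : 1 ≤ R)
        gcongr
        linarith
      rw [mul_pow] at this
      calc 2 * (2 * (R : ℝ) + 1) ^ d * J ≤ 2 * (3 ^ d * R ^ d) * J := by gcongr
        _ = _ := by ring) (by omega) (hR₁.trans (by exact_mod_cast hRR₁))
  have hpow : ∀ e : ℕ, (L : ℝ) ^ e ≤ 2 ^ (p * e) * (R : ℝ) ^ (p * e) := fun e => by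
    calc (L : ℝ) ^ e ≤ ((2 * R) ^ p) ^ e := by gcongr
      _ = _ := by rw [← pow_mul, mul_pow]
  rw [abs_of_nonneg (hf0 N)]
  calc f N * (L : ℝ) ^ K ≤ (D * ((L : ℝ) ^ a / (R : ℝ) ^ (p * (a + K))) +
        c * (L : ℝ) ^ b * (1 / 2) ^ R) * (L : ℝ) ^ K := by
        gcongr
        refine hmain.trans ?_
        gcongr
    _ = D * ((L : ℝ) ^ (a + K) / (R : ℝ) ^ (p * (a + K))) +
        c * ((L : ℝ) ^ (b + K) * (1 / 2) ^ R) := by rw [pow_add, pow_add]; ring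
    _ ≤ D * 2 ^ (p * (a + K)) +
        c * ((2 ^ (p * (b + K)) * (R : ℝ) ^ (p * (b + K))) * (1 / 2) ^ R) := by
        gcongr
        · rw [div_le_iff₀ (by positivity)]
          exact hpow _
        · exact hpow _
    _ = D * 2 ^ (p * (a + K)) +
        c * 2 ^ (p * (b + K)) * ((R : ℝ) ^ (p * (b + K)) * (1 / 2) ^ R) := by ring
    _ ≤ _ := by gcongr; exact hM R

end Asymptotics

section

open Set

lemma norm_conj_sub_conj_le_of_mem_unitary {A : Type*} [CStarAlgebra A] {v w : A} (q : A)
    (hv : v ∈ unitary A) (hw : w ∈ unitary A) :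
    ‖(star v * q * v - q) - (star w * q * w - q)‖ ≤ 2 * ‖v - w‖ * ‖q‖ := by
  have e : (star v * q * v - q) - (star w * q * w - q) =
      star v * (q * (v - w)) + star (v - w) * q * w := by
    rw [star_sub]
    noncomm_ring
  rw [e]
  calc _ ≤ ‖star v * (q * (v - w))‖ + ‖star (v - w) * q * w‖ := norm_add_le _ _
    _ = ‖q * (v - w)‖ + ‖star (v - w) * q‖ := by
        rw [CStarRing.norm_mem_unitary_mul _ (Unitary.star_mem hv),
          CStarRing.norm_mul_mem_unitary _ hw]
    _ ≤ ‖q‖ * ‖v - w‖ + ‖v - w‖ * ‖q‖ :=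
        add_le_add (norm_mul_le _ _) ((norm_mul_le _ _).trans_eq (by rw [norm_star]))
    _ = _ := by ring

lemma isSelfAdjoint_conj_sub {A : Type*} [CStarAlgebra A] {q : A} (hq : IsSelfAdjoint q) (v : A) :
    IsSelfAdjoint (star v * q * v - q) := (hq.conjugate' v).sub hq

/-! ### Localization, integrality and truncation at fixed volume. -/

section FixedVolume

variable {sp : Species} {n d L : ℕ} [NeZero L]

/-- A propagator generated by terms supported in `Z` is supported in `Z`. -/
lemma IsPropagator.apply_one_mem {Ψ : Finset (Torus d L) → ℝ → Op sp n d L}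
    (mem : ∀ X, ∀ s ∈ Icc (0 : ℝ) 1, Ψ X s ∈ localAlg sp X)
    (sa : ∀ X, ∀ s ∈ Icc (0 : ℝ) 1, IsSelfAdjoint (Ψ X s))
    (cont : ∀ X, ContinuousOn (Ψ X) (Icc (0 : ℝ) 1)) {Z : Finset (Torus d L)}
    {V : ℝ → Op sp n d L} (hV : IsPropagator (generatorIn Z Ψ) V) :
    V 1 ∈ localSubalgebra sp n Z := by
  have : CompleteSpace (localSubalgebra sp n Z) :=
    (localSubalgebra sp n Z).toSubmodule.closed_of_finiteDimensional.completeSpace_coe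
  exact hV.evolvesBy.mem_subalgebra (continuousOn_generatorIn cont Z)
    (isSelfAdjoint_generatorIn sa Z) _ fun s hs => Subalgebra.sum_mem _ fun X hX =>
      mem_localSubalgebra.2 (localAlg_mono (Finset.mem_powerset.1 hX) (mem X s hs))

variable [NeZero d] {Q : Torus d L → Op sp n d L}

/-- The charge transported by a unitary supported in `Z` is supported in `Z`. -/
lemma transported_mem (hQ : IsLocalCharge Q) {Z : Finset (Torus d L)} {V : Op sp n d L}
    (hVu : star V * V = 1) (hV : V ∈ localSubalgebra sp n Z) :
    transported Q V ∈ localSubalgebra sp n Z := by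
  have h1 : Commute V (charge Q (halfTorus d L \ Z)) :=
    localAlg_commute Finset.disjoint_sdiff (mem_localSubalgebra.1 hV)
      (mem_localSubalgebra.1 (charge_mem_localSubalgebra hQ _))
  have h2 : charge Q (halfTorus d L ∩ Z) ∈ localSubalgebra sp n Z :=
    mem_localSubalgebra.2 (localAlg_mono Finset.inter_subset_right
      (mem_localSubalgebra.1 (charge_mem_localSubalgebra hQ _)))
  have h3 : star V ∈ localSubalgebra sp n Z :=
    mem_localSubalgebra.2 (localAlg_star (mem_localSubalgebra.1 hV))
  -- The charge outside `Z` commutes with `V` and drops out.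
  have h4 : transported Q V =
      star V * charge Q (halfTorus d L ∩ Z) * V - charge Q (halfTorus d L ∩ Z) := by
    have h5 : star V * charge Q (halfTorus d L \ Z) * V = charge Q (halfTorus d L \ Z) := by
      rw [mul_assoc, ← h1.eq, ← mul_assoc, hVu, one_mul]
    rw [transported, charge_eq_inter_add_sdiff Q _ Z, mul_add, add_mul, h5]
    abel
  rw [h4]
  exact Subalgebra.sub_mem _ (Subalgebra.mul_mem _ (Subalgebra.mul_mem _ h3 h2) hV) h2

lemma isSelfAdjoint_transported (hQ : IsLocalCharge Q) (V : Op sp n d L) :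
    IsSelfAdjoint (transported Q V) :=
  isSelfAdjoint_conj_sub (hQ.selfAdjoint_charge _) V

lemma norm_transported_le {V : Op sp n d L} (hV : V ∈ unitary (Op sp n d L)) :
    ‖transported Q V‖ ≤ 2 * ‖charge Q (halfTorus d L)‖ := by
  rw [transported, two_mul]
  refine (norm_sub_le _ _).trans (add_le_add_left (le_of_eq ?_) _)
  rw [CStarRing.norm_mul_mem_unitary _ hV, CStarRing.norm_mem_unitary_mul _ (Unitary.star_mem hV)]

lemma norm_transported_sub_transported_le {V W : Op sp n d L} (hV : V ∈ unitary (Op sp n d L))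
    (hW : W ∈ unitary (Op sp n d L)) :
    ‖transported Q V - transported Q W‖ ≤ 2 * ‖V - W‖ * ‖charge Q (halfTorus d L)‖ :=
  norm_conj_sub_conj_le_of_mem_unitary _ hV hW

/-- The conjugated charge has integer spectrum, in exponential form. -/
lemma exp_charge_add_transported (hQ : IsLocalCharge Q) {V : Op sp n d L}
    (hV : V ∈ unitary (Op sp n d L)) :
    NormedSpace.exp ((2 * (Real.pi : ℂ) * Complex.I) •
      (charge Q (halfTorus d L) + transported Q V)) = 1 := by
  let : NormedAlgebra ℚ (Op sp n d L) := .restrictScalars ℚ ℝ _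
  set u := Unitary.toUnits ⟨V, hV⟩ with hu
  have e : (2 * (Real.pi : ℂ) * Complex.I) • (charge Q (halfTorus d L) + transported Q V) =
      (↑u⁻¹ : Op sp n d L) * ((2 * (Real.pi : ℂ) * Complex.I) • charge Q (halfTorus d L)) * u := by
    rw [transported, add_sub_cancel, mul_smul_comm, smul_mul_assoc]
    rfl
  rw [e, NormedSpace.exp_units_conj', hQ.exp_charge, mul_one, Units.inv_mul]

/-- The splitting of the transported charge, for an interaction that is close to its truncation. -/
theorem norm_transported_sub_le_of_truncate {Φ : Finset (Torus d L) → ℝ → Op sp n d L}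
    (hQ : IsLocalCharge Q) (heven : Even L) {R k : ℕ} {J δ : ℝ}
    (h : IsShortRange Q (truncate R Φ) R J) (sa : ∀ X, ∀ s ∈ Icc (0 : ℝ) 1, IsSelfAdjoint (Φ X s))
    (hδ : ∀ s ∈ Icc (0 : ℝ) 1, ∑ X with R ≤ diam X, ‖Φ X s‖ ≤ δ)
    (hk : k * (R + 1) + 3 * R + 1 ≤ L / 12) {U Uplus Uminus : ℝ → Op sp n d L}
    (hU : IsPropagator (generator Φ) U)
    (hUplus : IsPropagator (generatorIn (fatten (bdryPlus d L) (L / 12)) Φ) Uplus)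
    (hUminus : IsPropagator (generatorIn (fatten (bdryMinus d L) (L / 12)) Φ) Uminus) :
    ‖transported Q (U 1) - (transported Q (Uplus 1) + transported Q (Uminus 1))‖ ≤
      6 * δ * ‖charge Q (halfTorus d L)‖ +
      8 * ‖charge Q (halfTorus d L)‖ * ((L : ℝ) ^ d * J) ^ 2 *
        ((2 * (2 * R + 1) ^ d * J) ^ k / k.factorial) := by
  classical
  have h1 : (1 : ℝ) ∈ Icc (0 : ℝ) 1 := by simp
  -- Applied to each of the three propagators; three errors of `2 δ ‖Q‖` make up the 6.
  have step : ∀ {Z : Finset (Torus d L)} {V : ℝ → Op sp n d L},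
      IsPropagator (generatorIn Z Φ) V → ∃ W : ℝ → Op sp n d L,
        IsPropagator (generatorIn Z (truncate R Φ)) W ∧
        ‖transported Q (V 1) - transported Q (W 1)‖ ≤
          2 * δ * ‖charge Q (halfTorus d L)‖ := by
    intro Z V hV
    obtain ⟨W, hW⟩ := exists_evolvesBy (continuousOn_generatorIn h.continuousOn Z)
    have saV := isSelfAdjoint_generatorIn sa Z
    have saW := isSelfAdjoint_generatorIn h.selfAdjoint Z
    refine ⟨W, hW, (norm_transported_sub_transported_le (hV.evolvesBy.mem_unitary saV 1 h1)
      (hW.mem_unitary saW 1 h1)).trans ?_⟩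
    have := hV.evolvesBy.norm_sub_le hW saV saW (δ := δ) fun s hs => by
      rw [generatorIn, generatorIn, ← Finset.sum_sub_distrib]
      calc _ ≤ ∑ X ∈ Z.powerset, ‖Φ X s - truncate R Φ X s‖ := norm_sum_le _ _
        _ ≤ ∑ X, ‖Φ X s - truncate R Φ X s‖ :=
          Finset.sum_le_sum_of_subset_of_nonneg (Finset.subset_univ _) fun _ _ _ => norm_nonneg _
        _ = ∑ X with R ≤ diam X, ‖Φ X s‖ := by
          rw [Finset.sum_filter]
          refine Finset.sum_congr rfl fun X _ => ?_
          by_cases hX : R ≤ diam X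
          · rw [truncate, if_neg (not_lt.2 hX), if_pos hX, sub_zero]
          · rw [truncate, if_pos (not_le.1 hX), if_neg hX, sub_self, norm_zero]
        _ ≤ δ := hδ s hs
    gcongr
  rw [generator_eq_generatorIn] at hU
  obtain ⟨W, hW, hUW⟩ := step hU
  obtain ⟨Wp, hWp, hUWp⟩ := step hUplus
  obtain ⟨Wm, hWm, hUWm⟩ := step hUminus
  rw [← generator_eq_generatorIn] at hW
  have hmain := h.norm_transported_sub_le hQ heven hk hW hWp hWm
  have e : transported Q (U 1) - (transported Q (Uplus 1) + transported Q (Uminus 1)) =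
      (transported Q (U 1) - transported Q (W 1))
      - ((transported Q (Uplus 1) - transported Q (Wp 1))
        + (transported Q (Uminus 1) - transported Q (Wm 1)))
      + (transported Q (W 1) - (transported Q (Wp 1) + transported Q (Wm 1))) := by abel
  rw [e]
  have t1 := norm_add_le ((transported Q (U 1) - transported Q (W 1))
      - ((transported Q (Uplus 1) - transported Q (Wp 1))
        + (transported Q (Uminus 1) - transported Q (Wm 1))))
    (transported Q (W 1) - (transported Q (Wp 1) + transported Q (Wm 1)))
  have t2 := norm_sub_le (transported Q (U 1) - transported Q (W 1))
    ((transported Q (Uplus 1) - transported Q (Wp 1))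
        + (transported Q (Uminus 1) - transported Q (Wm 1)))
  have t3 := norm_add_le (transported Q (Uplus 1) - transported Q (Wp 1))
    (transported Q (Uminus 1) - transported Q (Wm 1))
  linarith

end FixedVolume

/-! ### Estimates uniform in the side length. -/

section Families

variable {sp : Species} {n d : ℕ} {Q : ∀ N, Torus d (side N) → Op sp n d (side N)}
  {Φ : ∀ N, Finset (Torus d (side N)) → ℝ → Op sp n d (side N)}

lemma sum_norm_univ_le {L : ℕ} [NeZero L] {f : Finset (Torus d L) → ℝ} (hf : ∀ X, 0 ≤ f X) {J : ℝ}
    (hJ : ∀ x, ∑ Y with x ∈ Y, f Y ≤ J) {R : ℕ} (hR : 1 ≤ R) :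
    ∑ X with R ≤ diam X, f X ≤ (L : ℝ) ^ d * J :=
  sum_norm_nonempty_le hf hJ _ fun Y hY => by
    rw [Finset.nonempty_iff_ne_empty]
    rintro rfl
    have := (Finset.mem_filter.1 hY).2
    rw [diam_empty] at this
    omega

lemma IsLocalGenerator.truncate {L : ℕ} [NeZero L] {Q : Torus d L → Op sp n d L}
    {Φ : Finset (Torus d L) → ℝ → Op sp n d L} {R : ℕ} {m : ℝ} (h : IsLocalGenerator Q Φ R m)
    (r : ℕ) : IsLocalGenerator Q (truncate r Φ) R m := by
  have h0 : 0 ≤ m := (norm_nonneg _).trans (h.strength ∅ 0 (left_mem_Icc.2 zero_le_one))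
  have e : ∀ X, ChargeTransport.truncate r Φ X = Φ X ∨ ChargeTransport.truncate r Φ X = 0 :=
    fun X => by
      by_cases hX : diam X < r
      · exact .inl (funext fun s => if_pos hX)
      · exact .inr (funext fun s => if_neg hX)
  refine ⟨fun X s hs => ?_, fun X s hs => ?_, fun X => ?_, fun X hX s hs => ?_, fun X s hs => ?_,
    fun X Y hXY s hs => ?_⟩ <;> rcases e X with h' | h' <;> rw [h']
  · exact h.mem X s hs
  · exact mem_localSubalgebra.1 (Subalgebra.zero_mem _)
  · exact h.selfAdjoint X s hs
  · exact IsSelfAdjoint.zero (R := Op sp n d L)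
  · exact h.continuousOn X
  · exact continuousOn_const
  · exact h.range X hX s hs
  · rfl
  · exact h.strength X s hs
  · simpa using h0
  · exact h.conserve X Y hXY s hs
  · exact Commute.zero_left _

/-- Finite-range generators have quasi-local tails. -/
theorem FiniteRange.quasiLocal (h : FiniteRange Q Φ) : QuasiLocal Q Φ := by
  classical
  obtain ⟨R, m, h⟩ := h
  have hm : 0 ≤ m := (norm_nonneg _).trans ((h 0).strength ∅ 0 (left_mem_Icc.2 zero_le_one))
  set J : ℝ := 2 ^ ((2 * R + 1) ^ d) * m with hJ
  have hJ0 : 0 ≤ J := by positivity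
  have per : ∀ N, ∀ s ∈ Icc (0 : ℝ) 1, ∀ x, ∑ X with x ∈ X, ‖Φ N X s‖ ≤ J := by
    intro N s hs x
    calc ∑ X with x ∈ X, ‖Φ N X s‖ = ∑ X with x ∈ X ∧ diam X ≤ R, ‖Φ N X s‖ := by
          symm
          refine Finset.sum_subset (fun X hX => ?_) fun X hX hX' => ?_
          · exact Finset.mem_filter.2 ⟨Finset.mem_univ _, (Finset.mem_filter.1 hX).2.1⟩
          · have h1 := (Finset.mem_filter.1 hX).2
            have h2 : ¬ diam X ≤ R := fun h2 =>
              hX' (Finset.mem_filter.2 ⟨Finset.mem_univ _, h1, h2⟩)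
            rw [(h N).range X (not_le.1 h2) s hs, norm_zero]
      _ ≤ ∑ X with x ∈ X ∧ diam X ≤ R, m := Finset.sum_le_sum fun X _ => (h N).strength X s hs
      _ ≤ J := by
          rw [Finset.sum_const, nsmul_eq_mul, hJ]
          gcongr
          exact_mod_cast card_filter_mem_diam_le x R
  refine ⟨fun r => ⟨R, m, fun N => (h N).truncate r⟩, fun k => ⟨J * R ^ k, fun r hr N s hs => ?_⟩,
    J, per⟩
  have hL : (0 : ℝ) < (side N : ℝ) ^ d := by
    have : 0 < side N := by simp [side]
    positivity
  have hr0 : (0 : ℝ) < (r : ℝ) ^ k := by positivity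
  rw [div_le_div_iff₀ hL hr0]
  -- For `r ≤ R` the crude volume bound suffices, as `r ^ k ≤ R ^ k`; for `r > R` the tail vanishes.
  rcases le_or_gt r R with hrR | hrR
  · calc _ ≤ ((side N : ℝ) ^ d * J) * (r : ℝ) ^ k := by
          gcongr
          exact sum_norm_univ_le (fun _ => norm_nonneg _) (per N s hs) hr
      _ ≤ ((side N : ℝ) ^ d * J) * (R : ℝ) ^ k := by gcongr
      _ = _ := by ring
  · rw [Finset.sum_eq_zero fun X hX => ?_]
    · rw [zero_mul]
      positivity
    · rw [(h N).range X (hrR.trans_le (Finset.mem_filter.1 hX).2) s hs, norm_zero]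

/-- The structural assumptions are made on truncations only, but each `X` survives the truncation at
`diam X + 1`. -/
lemma QuasiLocal.isSelfAdjoint (h : QuasiLocal Q Φ) (N : ℕ) (X : Finset (Torus d (side N))) :
    ∀ s ∈ Icc (0 : ℝ) 1, IsSelfAdjoint (Φ N X s) := by
  obtain ⟨R, m, hR⟩ := h.truncated (diam X + 1)
  have e : truncate (diam X + 1) (Φ N) X = Φ N X := funext fun s => if_pos (Nat.lt_succ_self _)
  exact e ▸ (hR N).selfAdjoint X

lemma QuasiLocal.mem (h : QuasiLocal Q Φ) (N : ℕ) (X : Finset (Torus d (side N))) :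
    ∀ s ∈ Icc (0 : ℝ) 1, Φ N X s ∈ localAlg sp X := by
  obtain ⟨R, m, hR⟩ := h.truncated (diam X + 1)
  have e : truncate (diam X + 1) (Φ N) X = Φ N X := funext fun s => if_pos (Nat.lt_succ_self _)
  exact e ▸ (hR N).mem X

lemma QuasiLocal.continuousOn (h : QuasiLocal Q Φ) (N : ℕ) (X : Finset (Torus d (side N))) :
    ContinuousOn (Φ N X) (Icc (0 : ℝ) 1) := by
  obtain ⟨R, m, hR⟩ := h.truncated (diam X + 1)
  have e : truncate (diam X + 1) (Φ N) X = Φ N X := funext fun s => if_pos (Nat.lt_succ_self _)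
  exact e ▸ (hR N).continuousOn X

/-- Truncations of quasi-local interactions are of short range, with a uniform strength per
site. -/
lemma QuasiLocal.isShortRange (h : QuasiLocal Q Φ) {J : ℝ}
    (hJ : ∀ N, ∀ s ∈ Icc (0 : ℝ) 1, ∀ x, ∑ X with x ∈ X, ‖Φ N X s‖ ≤ J) (N R : ℕ) :
    IsShortRange (Q N) (truncate R (Φ N)) R J := by
  -- `R'` and `m` may depend on `R` in any way and are discarded: the range comes from the cut-off,
  -- the strength from `J`.
  obtain ⟨R', m, hR⟩ := h.truncated R
  refine ⟨(hR N).mem, (hR N).selfAdjoint, (hR N).continuousOn, (hR N).conserve,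
    fun X hX s _ => if_neg (by omega), fun s hs x => le_trans (Finset.sum_le_sum fun X _ => ?_)
      (hJ N s hs x)⟩
  rw [truncate]
  split_ifs
  · exact le_rfl
  · rw [norm_zero]
    exact norm_nonneg _

/-- The transported charge of a quasi-local evolution splits into two boundary contributions. -/
theorem QuasiLocal.isVerySmall_transported_sub [NeZero d] (h : QuasiLocal Q Φ)
    (hQ : ∀ N, IsLocalCharge (Q N)) {q : ℝ}
    (hq : ∀ N, ‖charge (Q N) (halfTorus d (side N))‖ ≤ q * (side N : ℝ) ^ d)
    {U Uplus Uminus : ∀ N, ℝ → Op sp n d (side N)}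
    (hU : ∀ N, IsPropagator (generator (Φ N)) (U N))
    (hUplus : ∀ N, IsPropagator (generatorIn (fatten (bdryPlus d (side N)) (side N / 12))
      (Φ N)) (Uplus N))
    (hUminus : ∀ N, IsPropagator (generatorIn (fatten (bdryMinus d (side N)) (side N / 12))
      (Φ N)) (Uminus N)) :
    IsVerySmall fun N => ‖transported (Q N) (U N 1) -
      (transported (Q N) (Uplus N 1) + transported (Q N) (Uminus N 1))‖ := by
  have hL : ∀ N, (0 : ℝ) < (side N : ℝ) ^ d := fun N => by
    have : 0 < side N := by simp [side]
    positivity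
  have hq0 : 0 ≤ q := nonneg_of_mul_nonneg_left ((norm_nonneg _).trans (hq 0)) (hL 0)
  obtain ⟨J, hJ⟩ := h.perSite
  have hJ0 : 0 ≤ J := (h.isShortRange hJ 0 0).nonneg
  -- Volume factors: the tail and `‖Q‖` give `d + d`; `‖Q‖` and the two sums over terms give `d + (d
  -- + d)`.
  refine isVerySmall_of_le_tail_add_lieb_robinson (a := d + d) (b := d + (d + d)) (d := d) (J := J)
    (c := 8 * q * J ^ 2) (fun N => norm_nonneg _) hJ0 (by positivity) fun j => ?_
  obtain ⟨C, hC⟩ := h.tail j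
  refine ⟨6 * max C 0 * q, by positivity, fun N R k hR hk => ?_⟩
  have hRj : (0 : ℝ) < (R : ℝ) ^ j := by positivity
  have hδ : ∀ s ∈ Icc (0 : ℝ) 1, ∑ X with R ≤ diam X, ‖Φ N X s‖ ≤
      max C 0 / (R : ℝ) ^ j * (side N : ℝ) ^ d := fun s hs => by
    rw [← div_le_iff₀ (hL N)]
    refine (hC R hR N s hs).trans ?_
    gcongr
    exact le_max_left _ _
  refine (norm_transported_sub_le_of_truncate (hQ N) ⟨N + 1, by simp only [side]; ring⟩
    (h.isShortRange hJ N R) (h.isSelfAdjoint N) hδ hk (hU N) (hUplus N) (hUminus N)).trans ?_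
  have hqN := hq N
  calc _ ≤ 6 * (max C 0 / (R : ℝ) ^ j * (side N : ℝ) ^ d) * (q * (side N : ℝ) ^ d) +
        8 * (q * (side N : ℝ) ^ d) * ((side N : ℝ) ^ d * J) ^ 2 *
          ((2 * (2 * R + 1) ^ d * J) ^ k / k.factorial) := by gcongr
    _ = _ := by rw [pow_add, pow_add, pow_add]; ring

end Families

end

end ChargeTransport

theorem mainTheorem6
    (sp : Species) (n d : ℕ) [NeZero d]
    (Q : ∀ N, Torus d (side N) →
      Op sp n d (side N))
    (hQ : ∀ N, IsLocalCharge (Q N))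
    (hQnorm : ∃ q : ℝ, ∀ N,
      ‖charge (Q N) (halfTorus d (side N))‖
        ≤ q * (side N : ℝ) ^ d)
    (Φ : ∀ N, Finset (Torus d (side N)) → ℝ →
      Op sp n d (side N))
    (hΦ : FiniteRange Q Φ ∨ QuasiLocal Q Φ)
    (U Uplus Uminus : ∀ N, ℝ → Op sp n d (side N))
    (hU : ∀ N, IsPropagator (generator (Φ N)) (U N))
    (hUplus : ∀ N, IsPropagator
      (generatorIn (fatten
        (bdryPlus d (side N)) (side N / 12))
        (Φ N)) (Uplus N))
    (hUminus : ∀ N, IsPropagator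
      (generatorIn (fatten
        (bdryMinus d (side N)) (side N / 12))
        (Φ N)) (Uminus N))
    (Tplus Tminus : ∀ N, Op sp n d (side N))
    (hTplus : ∀ N, Tplus N = transported (Q N) (Uplus N 1))
    (hTminus : ∀ N, Tminus N = transported (Q N) (Uminus N 1)) :
    -- the transported charge splits, up to `O(L^{-∞})`
    IsVerySmall (fun N =>
      ‖transported (Q N) (U N 1) - (Tplus N + Tminus N)‖) ∧
    -- strict localization
    (∀ N, 16 ≤ side N →
      Tplus N ∈ localAlg sp
        (stripPlus d (side N)) ∧
      Tminus N ∈ localAlg sp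
        (stripMinus d (side N))) ∧
    (∀ N, IsSelfAdjoint (Tplus N) ∧ IsSelfAdjoint (Tminus N)) ∧
    -- the integrality constraint
    IsVerySmall (fun N =>
      ‖NormedSpace.exp ((2 * (Real.pi : ℂ) * Complex.I) •
        (charge (Q N) (halfTorus d (side N))
          + Tminus N)) - 1‖) ∧
    (∃ C : ℝ, ∀ N, ‖Tplus N‖ ≤ C * (side N : ℝ) ^ d ∧
      ‖Tminus N‖ ≤ C * (side N : ℝ) ^ d) := by
  obtain ⟨q, hq⟩ := hQnorm
  have h : QuasiLocal Q Φ := hΦ.elim FiniteRange.quasiLocal id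
  have h1 : (1 : ℝ) ∈ Set.Icc (0 : ℝ) 1 := by simp
  have hup : ∀ N, Uplus N 1 ∈ unitary (Op sp n d (side N)) := fun N =>
    (hUplus N).evolvesBy.mem_unitary (isSelfAdjoint_generatorIn (h.isSelfAdjoint N) _) 1 h1
  have hum : ∀ N, Uminus N 1 ∈ unitary (Op sp n d (side N)) := fun N =>
    (hUminus N).evolvesBy.mem_unitary (isSelfAdjoint_generatorIn (h.isSelfAdjoint N) _) 1 h1
  obtain rfl : Tplus = fun N => transported (Q N) (Uplus N 1) := funext hTplus
  obtain rfl : Tminus = fun N => transported (Q N) (Uminus N 1) := funext hTminus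
  refine ⟨h.isVerySmall_transported_sub hQ hq hU hUplus hUminus, fun N hN => ⟨?_, ?_⟩,
    fun N => ⟨isSelfAdjoint_transported (hQ N) _, isSelfAdjoint_transported (hQ N) _⟩,
    fun k => ⟨0, fun N => ?_⟩, 2 * q, fun N => ⟨?_, ?_⟩⟩
  · exact localAlg_mono (fatten_bdryPlus_subset_strip hN) (mem_localSubalgebra.1
      (transported_mem (hQ N) (Unitary.mem_iff.1 (hup N)).1
        ((hUplus N).apply_one_mem (h.mem N) (h.isSelfAdjoint N) (h.continuousOn N))))
  · exact localAlg_mono fatten_bdryMinus_subset_strip (mem_localSubalgebra.1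
      (transported_mem (hQ N) (Unitary.mem_iff.1 (hum N)).1
        ((hUminus N).apply_one_mem (h.mem N) (h.isSelfAdjoint N) (h.continuousOn N))))
  -- The constant is 0: the exponential equals 1 exactly.
  · dsimp only
    rw [exp_charge_add_transported (hQ N) (hum N)]
    simp
  · exact (norm_transported_le (hup N)).trans (by linarith [hq N])
  · exact (norm_transported_le (hum N)).trans (by linarith [hq N])
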